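/- Let $D_0\subset\mathbb{R}^2\simeq\mathbb{C}$ be the open unit disk. For real $\mathcal{E},h,\mu$ with $\mathcal{E}+h>0$ and $\mu>0$ put $V_I(z)=\mathcal{E}+h+\mu/|z|$ for $z\neq0$, and write $(HS_I)[z]$ for the system $z''=\nabla V_I(z)$, $\tfrac12|z'|^2-V_I(z)=0$. For $p_0,p_1\in\partial D_0$ consider the problem $$(P)\qquad (HS_I)[z(s)]\ \text{ for } s\in[0,T],\qquad |z(s)|<1\ \text{ for } s\in(0,T),\qquad z(0)=p_0,\ z(T)=p_1,\qquad T>0 .$$ A classical solution satisfies $z(s)\ne 0$ and $(HS_I)$ on all of $[0,T]$. An ejection-collision solution is a continuous $z:[0,T]\to\mathbb{R}^2$ that vanishes at exactly one time $c\in(0,T)$, satisfies $(HS_I)$ on $[0,T]\setminus\{c\}$ and the remaining conditions of $(P)$, and for which $z(s)/|z(s)|$ has a limit as $s\to c$. If $p_0,p_1$ are non-antipodal ($|p_0-p_1|<2$), the winding index of a $C^1$ curve $z$ from $p_0$ to $p_1$ avoiding $0$ is $\mathrm{Ind}(z([0,T]),0)=\frac1{2\pi i}\int_\Gamma \frac{d\zeta}{\zeta}$,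 where $\Gamma$ is $z$ followed by the shortest arc of $\partial D_0$ from $p_1$ to $p_0$. **Theorem.** For all $p_0,p_1\in\partial D_0$ with $|p_0-p_1|<2$ there are $T=T(p_0,p_1)>0$ and a solution $z(\cdot;p_0,p_1)$ of $(P)$ such that: * if $p_0=p_1$, then $z(\cdot;p_0,p_0)$ is an ejection-collision solution, and $(T,z)$ is unique among all classical and ejection-collision solutions of $(P)$; * if $p_0\neq p_1$, then $z(\cdot;p_0,p_1)$ is a classical solution of $(P)$, it is a simple curve, $|\mathrm{Ind}(z([0,T]),0)|=1$, and $(T,z)$ is unique among the classical solutions of $(P)$ whose index has modulus $1$; * $T$ and $z$ are of class $C^1$ with respect to the endpoints: writing $p_j=e^{i\xi_j}$, the map $(\xi_0,\xi_1)\mapsto T(p_0,p_1)$ is $C^1$; for every fixed $s$ the map $(\xi_0,\xi_1)\mapsto z(s;p_0,p_1)$ is $C^1$ on the set where $0\le s\le T(p_0,p_1)$; and $(s,\xi_0,\xi_1)\mapsto z(s;p_0,p_1)$ is $C^1$ on the set where $0\le s\le T(p_0,p_1)$ and $z(s;p_0,p_1)\neq0$; * as $p_1\to p_0$ on $\partial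 D_0$, $T(p_0,p_1)\to T(p_0,p_0)$ and $z(t\,T(p_0,p_1);p_0,p_1)\to z(t\,T(p_0,p_0);p_0,p_0)$ uniformly in $t\in[0,1]$. Moreover, there is a quantity $C=C(\mathcal{E}+h,\mu,|p_0-p_1|)$, bounded below by some $C_0=C_0(\mathcal{E}+h,\mu)$ with $0<C_0\le C<1$, such that for all $p_0,p_1$ as above $$-p_0\cdot\frac{z'(0;p_0,p_1)}{|z'(0;p_0,p_1)|}>C\qquad\text{and}\qquad p_1\cdot\frac{z'(T;p_0,p_1)}{|z'(T;p_0,p_1)|}>C ;$$ for fixed $\mu$, $C_0\to1$ (hence $C\to1$ uniformly in the endpoints) as $\mathcal{E}+h\to\infty$, in particular as $\mathcal{E}\to\infty$ with $h$ fixed; and, for fixed $\mathcal{E}+h$ and $\mu$, $C\to1$ as $|p_0-p_1|\to0$ with $p_0\ne p_1$. -/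

import Mathlib

open Set Filter Topology

/-- The inner (Kepler) potential `V_I(z) = E + h + μ / |z|` on the plane `ℝ² = ℂ`. -/
noncomputable def innerPotential (E h μ : ℝ) (z : ℂ) : ℝ := E + h + μ / ‖z‖

/-- Sanity check: `∇ V_I(z) = - μ z / |z|³` away from the origin. -/
theorem hasGradientAt_innerPotential (E h μ : ℝ) {z : ℂ} (hz : z ≠ 0) :
    HasGradientAt (innerPotential E h μ) (-(μ / ‖z‖ ^ 3) • z) z := by
  have hn : ‖z‖ ≠ 0 := norm_ne_zero_iff.mpr hz
  have h1 : HasFDerivAt (fun w : ℂ => ‖w‖ ^ 2) (2 • (innerSL ℝ z)) z :=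
    (hasStrictFDerivAt_norm_sq z).hasFDerivAt
  have h2 : HasFDerivAt (fun w : ℂ => ‖w‖) ((1 / (2 * ‖z‖)) • (2 • (innerSL ℝ z))) z := by
    have h3 := h1.sqrt (by positivity)
    simpa [Real.sqrt_sq (norm_nonneg _)] using h3
  have h4 : HasDerivAt (fun r : ℝ => E + h + μ / r) (-(μ / ‖z‖ ^ 2)) ‖z‖ := by
    have h5 := ((hasDerivAt_inv hn).const_mul μ).const_add (E + h)
    refine (h5.congr_deriv ?_).congr_of_eventuallyEq (Eventually.of_forall fun r => ?_)
    · field_simp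
    · simp [div_eq_mul_inv]
  rw [hasGradientAt_iff_hasFDerivAt]
  refine (h4.comp_hasFDerivAt z h2).congr_fderiv ?_
  refine ContinuousLinearMap.ext fun w => ?_
  rw [InnerProductSpace.toDual_apply_apply, real_inner_smul_left]
  simp only [smul_apply, innerSL_apply_apply, smul_eq_mul, nsmul_eq_mul]
  field_simp
  norm_num

/-- `(HS_I)[z]` on a set `S` of times: `z` avoids the origin, is twice differentiable on `S`
(one-sidedly at end times), and satisfies `z'' = ∇ V_I(z)` and `|z'|² / 2 - V_I(z) = 0`. -/
def SolvesInner (E h μ : ℝ) (z : ℝ → ℂ) (S : Set ℝ) : Prop :=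
  ∃ v : ℝ → ℂ, ∀ s ∈ S,
    z s ≠ 0 ∧
    HasDerivWithinAt z (v s) S s ∧
    HasDerivWithinAt v (gradient (innerPotential E h μ) (z s)) S s ∧
    1 / 2 * ‖v s‖ ^ 2 - innerPotential E h μ (z s) = 0

/-- `z` on `[0, T]` goes from `p₀` to `p₁` and stays in the open unit disk in between. -/
structure JoinsInside (p₀ p₁ : ℂ) (T : ℝ) (z : ℝ → ℂ) : Prop where
  pos : 0 < T
  left : z 0 = p₀
  right : z T = p₁
  inside : ∀ s ∈ Ioo 0 T, ‖z s‖ < 1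

/-- Classical (collisionless) solution of the inner fixed ends problem in the disk. -/
def IsClassicalArc (E h μ : ℝ) (p₀ p₁ : ℂ) (T : ℝ) (z : ℝ → ℂ) : Prop :=
  JoinsInside p₀ p₁ T z ∧ SolvesInner E h μ z (Icc 0 T)

/-- Ejection-collision solution of the inner fixed ends problem in the disk: a continuous curve
that reaches the origin at exactly one time `c`, solves `(HS_I)` at all other times, and leaves
the origin in the direction from which it arrived (as prescribed by the Levi-Civita
regularisation). -/
def IsEjectionCollisionArc (E h μ : ℝ) (p₀ p₁ : ℂ) (T : ℝ) (z : ℝ → ℂ) : Prop :=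
  JoinsInside p₀ p₁ T z ∧ ContinuousOn z (Icc 0 T) ∧
    ∃ c ∈ Ioo 0 T, z c = 0 ∧ SolvesInner E h μ z (Icc 0 T \ {c}) ∧
      ∃ u : ℂ, Tendsto (fun s => z s / (‖z s‖ : ℂ)) (𝓝[≠] c) (𝓝 u)

/-- The shortest arc of the unit circle from `p` to `q` (`p`, `q` non-antipodal points of the
circle), parametrised by `t ∈ [0, 1]`. -/
noncomputable def shortestArc (p q : ℂ) (t : ℝ) : ℂ :=
  p * Complex.exp (t * Complex.arg (q / p) * Complex.I)

/-- The winding index with respect to the origin of a curve `α` on `[a, b]` whose end points are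
non-antipodal points of the unit circle: `(2πi)⁻¹ ∫_Γ dz / z`, where the closed curve `Γ` follows
`α` and then the shortest arc of the circle from `α b` to `α a`. -/
noncomputable def openCurveIndex (α : ℝ → ℂ) (a b : ℝ) : ℂ :=
  1 / (2 * Real.pi * Complex.I) *
    ((∫ s in a..b, derivWithin α (Icc a b) s / α s) +
      ∫ t in (0 : ℝ)..1,
        deriv (shortestArc (α b) (α a)) t / shortestArc (α b) (α a) t)

/-- `p₀` and `p₁` lie on the unit circle and `|p₀ - p₁| < 2`. -/
def NonAntipodal (p₀ p₁ : ℂ) : Prop := ‖p₀‖ = 1 ∧ ‖p₁‖ = 1 ∧ ‖p₀ - p₁‖ < 2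

/-- The point of the unit circle with polar angle `ξ`. -/
noncomputable def circlePoint (ξ : ℝ) : ℂ := Complex.exp (ξ * Complex.I)

/-!
The solutions of energy `E + h` are arcs of hyperbolas with semi-axis `a = μ / (2 (E + h))` and
focus `0`. In the frame in which the end points are `c ± δ i`, with `c = √(1 - δ²) > 0`, the
conditions at the unit circle determine the eccentricity `ε` and the hyperbolic cosine of the
eccentric anomaly at the end as the positive roots of two quadratic equations, and Kepler's
equation `ε sinh u - u = n s - M` gives the position at time `s`. The hyperbola degenerates to the
ejection-collision motion as `δ → 0`, since then `ε → 1`. Everything is smooth in `δ` except `u`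
at the collision, where Kepler's equation is cubically degenerate: `δ²` is of order `u³` along the
family, and this is enough for the position at a fixed time to be `C¹`.

For uniqueness of the classical solutions, Levi-Civita's change of variables turns the square root
`w = √z` of a solution into `A cosh (u / 2) + B sinh (u / 2)`. The index of `z` fixes the sign by
which the square roots of the end points are related, and these, together with the energy,
determine `z` and the time. An ejection-collision solution has vanishing angular momentum, because
its direction converges at the collision; it therefore falls along a ray, at a distance that the
time of fall determines.

The bounds on the angles come from the identity for the squared cosine at the end points,
`1 - a² (ε² - 1) / (1 + 2 a)`, together with `1 ≤ ε` and `ε² < 1 + 1 / a`.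
-/

namespace HyperbolicKepler

open Real

/-! ### Kepler's equation for hyperbolic orbits -/

/-- The left-hand side `ε sinh u - u` of Kepler's equation for hyperbolic orbits. -/
noncomputable def kepler (ε u : ℝ) : ℝ := ε * sinh u - u

/-- The eccentric anomaly `u` solving `ε sinh u - u = M`; it exists and is unique for `1 ≤ ε`. -/
noncomputable def keplerInv (ε M : ℝ) : ℝ := Function.invFun (kepler ε) M

theorem one_add_sq_div_two_le_cosh (u : ℝ) : 1 + u ^ 2 / 2 ≤ cosh u := by
  have half_angle : cosh u = 1 + 2 * sinh (u / 2) ^ 2 := by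
    have := cosh_two_mul (u / 2)
    rw [mul_div_cancel₀ u two_ne_zero, cosh_sq] at this
    linarith
  have half_le : (u / 2) ^ 2 ≤ sinh (u / 2) ^ 2 := by
    rw [sq_le_sq, abs_sinh]
    exact self_le_sinh_iff.mpr (abs_nonneg _)
  linarith

theorem cosh_sub_one_le_sq {u : ℝ} (hu : |u| ≤ 1) : cosh u - 1 ≤ u ^ 2 := by
  have hsq : |u ^ 2 / 2| = u ^ 2 / 2 := abs_of_nonneg (by positivity)
  have hle : |u ^ 2 / 2| ≤ 1 := by rw [hsq]; linarith [(sq_le_one_iff_abs_le_one u).mpr hu]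
  linarith [cosh_le_exp_half_sq u, le_of_abs_le (abs_exp_sub_one_le hle)]

theorem kepler_neg (ε u : ℝ) : kepler ε (-u) = -kepler ε u := by
  simp only [kepler, sinh_neg]
  ring

theorem kepler_zero (ε : ℝ) : kepler ε 0 = 0 := by simp [kepler]

theorem hasDerivAt_kepler (ε u : ℝ) : HasDerivAt (kepler ε) (ε * cosh u - 1) u :=
  ((hasDerivAt_sinh u).const_mul ε).sub (hasDerivAt_id u)

theorem continuous_kepler (ε : ℝ) : Continuous (kepler ε) :=
  continuous_iff_continuousAt.mpr fun u => (hasDerivAt_kepler ε u).continuousAt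

theorem cube_le_kepler {ε u : ℝ} (hε : 1 ≤ ε) (hu : 0 ≤ u) : u ^ 3 / 6 ≤ kepler ε u := by
  have hderiv (t : ℝ) : HasDerivAt (fun t => kepler 1 t - t ^ 3 / 6)
      (1 * cosh t - 1 - 3 * t ^ 2 / 6) t :=
    (hasDerivAt_kepler 1 t).sub (by simpa using (hasDerivAt_pow 3 t).div_const 6)
  have hmono : Monotone fun t => kepler 1 t - t ^ 3 / 6 :=
    monotone_of_deriv_nonneg (fun t => (hderiv t).differentiableAt) fun t => by
      rw [(hderiv t).deriv]
      linarith [one_add_sq_div_two_le_cosh t]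
  have hone : u ^ 3 / 6 ≤ kepler 1 u := by simpa [kepler_zero] using hmono hu
  have hsinh : 0 ≤ sinh u := sinh_nonneg_iff.mpr hu
  simp only [kepler] at hone ⊢
  nlinarith

theorem abs_cube_le_kepler {ε : ℝ} (hε : 1 ≤ ε) (u : ℝ) : |u| ^ 3 / 6 ≤ |kepler ε u| := by
  rcases le_total 0 u with hu | hu
  · rw [abs_of_nonneg hu]
    exact (cube_le_kepler hε hu).trans (le_abs_self _)
  · rw [abs_of_nonpos hu, ← abs_neg, ← kepler_neg]
    exact (cube_le_kepler hε (neg_nonneg.mpr hu)).trans (le_abs_self _)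

theorem abs_kepler_one_le {u : ℝ} (hu : |u| ≤ 1) : |kepler 1 u| ≤ |u| ^ 3 := by
  have hbound (t : ℝ) (ht : t ∈ Icc (-|u|) |u|) : ‖1 * cosh t - 1‖ ≤ u ^ 2 := by
    have htu : |t| ≤ |u| := abs_le.mpr ht
    rw [one_mul, norm_of_nonneg (sub_nonneg.mpr (one_le_cosh t))]
    exact (cosh_sub_one_le_sq (htu.trans hu)).trans (sq_le_sq.mpr htu)
  have := (convex_Icc (-|u|) |u|).norm_image_sub_le_of_norm_hasDerivWithin_le
    (fun t _ => (hasDerivAt_kepler 1 t).hasDerivWithinAt) hbound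
    (x := 0) (y := u) (by simp) ⟨neg_abs_le u, le_abs_self u⟩
  rwa [kepler_zero, sub_zero, sub_zero, norm_eq_abs, norm_eq_abs, ← sq_abs, ← pow_succ] at this

theorem strictMono_kepler {ε : ℝ} (hε : 1 ≤ ε) : StrictMono (kepler ε) := by
  have hsum : kepler ε = fun u => (ε - 1) * sinh u + (sinh u - u) := by
    ext u
    simp only [kepler]
    ring
  rw [hsum]
  exact (sinh_strictMono.monotone.const_mul (sub_nonneg.mpr hε)).add_strictMono
    sinh_sub_id_strictMono

theorem surjective_kepler {ε : ℝ} (hε : 1 ≤ ε) : Function.Surjective (kepler ε) := by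
  have htop : Tendsto (kepler ε) atTop atTop := by
    refine tendsto_atTop_mono' atTop ?_ ((tendsto_pow_atTop three_ne_zero).atTop_div_const
      (show (0 : ℝ) < 6 by norm_num))
    filter_upwards [eventually_ge_atTop 0] with u hu using cube_le_kepler hε hu
  have hodd : kepler ε = fun u => -kepler ε (-u) := by
    ext u
    rw [kepler_neg, neg_neg]
  refine (continuous_kepler ε).surjective htop ?_
  rw [hodd]
  exact tendsto_neg_atTop_atBot.comp (htop.comp tendsto_neg_atBot_atTop)

theorem kepler_keplerInv {ε : ℝ} (hε : 1 ≤ ε) (M : ℝ) : kepler ε (keplerInv ε M) = M :=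
  Function.invFun_eq (surjective_kepler hε M)

theorem keplerInv_kepler {ε : ℝ} (hε : 1 ≤ ε) (u : ℝ) : keplerInv ε (kepler ε u) = u :=
  Function.leftInverse_invFun (strictMono_kepler hε).injective u

theorem keplerInv_eq_iff {ε : ℝ} (hε : 1 ≤ ε) {M u : ℝ} : keplerInv ε M = u ↔ kepler ε u = M :=
  ⟨fun h => h ▸ kepler_keplerInv hε M, fun h => h ▸ keplerInv_kepler hε u⟩

theorem strictMono_keplerInv {ε : ℝ} (hε : 1 ≤ ε) : StrictMono (keplerInv ε) := fun M N h => by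
  rwa [← (strictMono_kepler hε).lt_iff_lt, kepler_keplerInv hε, kepler_keplerInv hε]

theorem continuous_keplerInv {ε : ℝ} (hε : 1 ≤ ε) : Continuous (keplerInv ε) :=
  (strictMono_keplerInv hε).monotone.continuous_of_surjective fun u =>
    ⟨kepler ε u, keplerInv_kepler hε u⟩

theorem hasDerivAt_keplerInv {ε M : ℝ} (hε : 1 ≤ ε) (h : ε * cosh (keplerInv ε M) - 1 ≠ 0) :
    HasDerivAt (keplerInv ε) (ε * cosh (keplerInv ε M) - 1)⁻¹ M :=
  HasDerivAt.of_local_left_inverse (continuous_keplerInv hε).continuousAt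
    (hasDerivAt_kepler ε _) h (Eventually.of_forall (kepler_keplerInv hε))

theorem isInvertible_of_apply_one_ne_zero {𝕜 : Type*} [NontriviallyNormedField 𝕜] {f : 𝕜 →L[𝕜] 𝕜}
    (hf : f 1 ≠ 0) : f.IsInvertible :=
  ⟨ContinuousLinearEquiv.unitsEquivAut 𝕜 (Units.mk0 (f 1) hf), by ext; simp⟩

/-- `keplerInv` carries no information for `ε < 1`, hence the extension `ψ` of its restriction to
`1 ≤ ε`. -/
theorem exists_contDiffAt_eq_keplerInv {ε M : ℝ} (hε : 1 ≤ ε)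
    (h : ε * cosh (keplerInv ε M) - 1 ≠ 0) :
    ∃ ψ : ℝ × ℝ → ℝ, ContDiffAt ℝ 1 ψ (ε, M) ∧
      ∀ᶠ x in 𝓝 (ε, M), 1 ≤ x.1 → keplerInv x.1 x.2 = ψ x := by
  let f : (ℝ × ℝ) × ℝ → ℝ := fun x => x.1.1 * sinh x.2 - x.2 - x.1.2
  set u := keplerInv ε M
  have hf : ContDiff ℝ 1 f := by
    have : ContDiff ℝ 1 sinh := contDiff_sinh
    fun_prop
  have hpartial : (fderiv ℝ f ((ε, M), u) ∘L .inr ℝ (ℝ × ℝ) ℝ) 1 = ε * cosh u - 1 := by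
    have hline : HasDerivAt (fun t : ℝ => (((ε, M), t) : (ℝ × ℝ) × ℝ)) ((0, 0), 1) u :=
      (hasDerivAt_const u (ε, M)).prodMk (hasDerivAt_id u)
    exact ((hf.differentiable one_ne_zero _).hasFDerivAt.comp_hasDerivAt u hline).unique
      ((hasDerivAt_kepler ε u).sub_const M)
  have hinv : (fderiv ℝ f ((ε, M), u) ∘L .inr ℝ (ℝ × ℝ) ℝ).IsInvertible :=
    isInvertible_of_apply_one_ne_zero (by rwa [hpartial])
  have hfa : ContDiffAt ℝ 1 f ((ε, M), u) := hf.contDiffAt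
  refine ⟨hfa.implicitFunction one_ne_zero hinv, hfa.contDiffAt_implicitFunction one_ne_zero hinv,
    ?_⟩
  filter_upwards [hfa.eventually_apply_implicitFunction one_ne_zero hinv] with x hx h1x
  have h0 : f ((ε, M), u) = 0 := sub_eq_zero.mpr (kepler_keplerInv hε M)
  rw [h0] at hx
  exact (keplerInv_eq_iff h1x).mpr (sub_eq_zero.mp hx)

theorem contDiffAt_keplerInv {X : Type*} [NormedAddCommGroup X] [NormedSpace ℝ X] {ε M : X → ℝ}
    {x₀ : X} (hε : ContDiffAt ℝ 1 ε x₀) (hM : ContDiffAt ℝ 1 M x₀) (h1 : ∀ᶠ x in 𝓝 x₀, 1 ≤ ε x)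
    (h : ε x₀ * cosh (keplerInv (ε x₀) (M x₀)) - 1 ≠ 0) :
    ContDiffAt ℝ 1 (fun x => keplerInv (ε x) (M x)) x₀ := by
  obtain ⟨ψ, hψ, hψ_eq⟩ := exists_contDiffAt_eq_keplerInv h1.self_of_nhds h
  have hpair : ContDiffAt ℝ 1 (fun x => (ε x, M x)) x₀ := hε.prodMk hM
  refine (ContDiffAt.comp x₀ (g := ψ) hψ hpair).congr_of_eventuallyEq ?_
  filter_upwards [hpair.continuousAt.eventually hψ_eq, h1] with x hx h1x using hx h1x

theorem tendsto_zero_of_abs_pow {α : Type*} {l : Filter α} {f : α → ℝ} {n : ℕ} (hn : n ≠ 0)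
    (h : Tendsto (fun x => |f x| ^ n) l (𝓝 0)) : Tendsto f l (𝓝 0) := by
  have hroot := h.rpow_const (p := (n : ℝ)⁻¹) (Or.inr (by positivity))
  rw [zero_rpow (by positivity)] at hroot
  exact (tendsto_zero_iff_abs_tendsto_zero f).mpr
    (hroot.congr fun x => pow_rpow_inv_natCast (abs_nonneg _) hn)

theorem tendsto_keplerInv_zero {α : Type*} {l : Filter α} {ε M : α → ℝ}
    (hM : Tendsto M l (𝓝 0)) (hε : ∀ᶠ x in l, 1 ≤ ε x) :
    Tendsto (fun x => keplerInv (ε x) (M x)) l (𝓝 0) := by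
  refine tendsto_zero_of_abs_pow three_ne_zero ?_
  have hmajorant : Tendsto (fun x => 6 * |M x|) l (𝓝 0) := by
    simpa using hM.abs.const_mul 6
  refine squeeze_zero' (Eventually.of_forall fun x => by positivity) ?_ hmajorant
  filter_upwards [hε] with x hx
  have := abs_cube_le_kepler hx (keplerInv (ε x) (M x))
  rw [kepler_keplerInv hx] at this
  linarith

theorem tendsto_keplerInv {α : Type*} {l : Filter α} {ε M : α → ℝ} {ε₀ M₀ : ℝ} (h₀ : 1 ≤ ε₀)
    (hε : Tendsto ε l (𝓝 ε₀)) (hM : Tendsto M l (𝓝 M₀)) (h1 : ∀ᶠ x in l, 1 ≤ ε x) :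
    Tendsto (fun x => keplerInv (ε x) (M x)) l (𝓝 (keplerInv ε₀ M₀)) := by
  rcases eq_or_ne (keplerInv ε₀ M₀) 0 with hu | hu
  · have hM₀ : M₀ = 0 := by rw [← kepler_keplerInv h₀ M₀, hu, kepler_zero]
    rw [hu]
    exact tendsto_keplerInv_zero (hM₀ ▸ hM) h1
  · have hne : ε₀ * cosh (keplerInv ε₀ M₀) - 1 ≠ 0 := by nlinarith [one_lt_cosh.mpr hu]
    obtain ⟨ψ, hψ, hψ_eq⟩ := exists_contDiffAt_eq_keplerInv h₀ hne
    have hpair : Tendsto (fun x => (ε x, M x)) l (𝓝 (ε₀, M₀)) := hε.prodMk_nhds hM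
    rw [hψ_eq.self_of_nhds h₀]
    refine (hψ.continuousAt.tendsto.comp hpair).congr' ?_
    filter_upwards [hpair.eventually hψ_eq, h1] with x hx h1x using (hx h1x).symm

/-! ### Orbit elements as functions of the end points -/

/-- The square root of the discriminant of `a ε² + c ε = a + 1`, the equation for the eccentricity
of the hyperbola with semi-axis `a` that passes, with component `c` along its axis, through the
unit circle centred at its focus. -/
noncomputable def disc (a c : ℝ) : ℝ := √(c ^ 2 + 4 * a ^ 2 + 4 * a)

/-- The eccentricity of the orbit with semi-axis `a` whose end points, on the unit circle, have
component `c` along the axis. -/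
noncomputable def ecc (a c : ℝ) : ℝ := (disc a c - c) / (2 * a)

/-- The hyperbolic cosine of the eccentric anomaly at the end of the orbit. -/
noncomputable def endCosh (a c : ℝ) : ℝ := (disc a c + c) / (2 * a)

/-- The hyperbolic sine of the eccentric anomaly at the end of the orbit. -/
noncomputable def endSinh (a c : ℝ) : ℝ := √(endCosh a c ^ 2 - 1)

/-- The eccentric anomaly at the end of the orbit. -/
noncomputable def endAnomaly (a c : ℝ) : ℝ := arcosh (endCosh a c)

/-- The mean anomaly at the end of the orbit. -/
noncomputable def endMean (a c : ℝ) : ℝ := kepler (ecc a c) (endAnomaly a c)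

section Elements

variable {a c : ℝ}

theorem disc_sq (ha : 0 < a) (c : ℝ) : disc a c ^ 2 = c ^ 2 + 4 * a ^ 2 + 4 * a :=
  sq_sqrt (by positivity)

theorem disc_pos (ha : 0 < a) (c : ℝ) : 0 < disc a c := sqrt_pos.mpr (by positivity)

theorem disc_one (ha : 0 < a) : disc a 1 = 2 * a + 1 := by
  rw [disc, show (1 : ℝ) ^ 2 + 4 * a ^ 2 + 4 * a = (2 * a + 1) ^ 2 by ring,
    sqrt_sq (by positivity)]

theorem abs_lt_disc (ha : 0 < a) (c : ℝ) : |c| < disc a c := by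
  rw [← sqrt_sq_eq_abs]
  exact sqrt_lt_sqrt (sq_nonneg c) (by nlinarith)

theorem endCosh_sub_ecc (ha : 0 < a) (c : ℝ) : a * (endCosh a c - ecc a c) = c := by
  unfold endCosh ecc
  field_simp
  ring

theorem ecc_mul_endCosh (ha : 0 < a) (c : ℝ) : a * (ecc a c * endCosh a c) = a + 1 := by
  have := disc_sq ha c
  unfold endCosh ecc
  field_simp
  linarith

theorem ecc_quadratic (ha : 0 < a) (c : ℝ) : a * ecc a c ^ 2 + c * ecc a c = a + 1 := by
  linear_combination ecc_mul_endCosh ha c - ecc a c * endCosh_sub_ecc ha c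

theorem endCosh_quadratic (ha : 0 < a) (c : ℝ) : a * endCosh a c ^ 2 - c * endCosh a c = a + 1 := by
  linear_combination ecc_mul_endCosh ha c + endCosh a c * endCosh_sub_ecc ha c

theorem ecc_pos (ha : 0 < a) (c : ℝ) : 0 < ecc a c := by
  have := (le_abs_self c).trans_lt (abs_lt_disc ha c)
  exact div_pos (by linarith) (by positivity)

theorem endCosh_pos (ha : 0 < a) (c : ℝ) : 0 < endCosh a c := by
  have := (neg_le_abs c).trans_lt (abs_lt_disc ha c)
  exact div_pos (by linarith) (by positivity)

theorem one_lt_endCosh (ha : 0 < a) (hc : -1 < c) : 1 < endCosh a c := by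
  by_contra! h
  nlinarith [endCosh_quadratic ha c, endCosh_pos ha c,
    mul_nonneg ha.le (mul_nonneg (sub_nonneg.mpr h) (endCosh_pos ha c).le)]

theorem one_le_ecc (ha : 0 < a) (hc : c ≤ 1) : 1 ≤ ecc a c := by
  by_contra! h
  nlinarith [ecc_quadratic ha c, ecc_pos ha c, mul_pos ha (mul_pos (sub_pos.mpr h) (ecc_pos ha c))]

theorem one_lt_ecc (ha : 0 < a) (hc : c < 1) : 1 < ecc a c := by
  by_contra! h
  nlinarith [ecc_quadratic ha c, ecc_pos ha c,
    mul_nonneg ha.le (mul_nonneg (sub_nonneg.mpr h) (ecc_pos ha c).le)]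

theorem ecc_sq_lt (ha : 0 < a) (hc : 0 < c) : ecc a c ^ 2 < 1 + 1 / a := by
  rw [show 1 + 1 / a = (a + 1) / a by field_simp, lt_div_iff₀ ha]
  nlinarith [ecc_quadratic ha c, mul_pos hc (ecc_pos ha c)]

theorem ecc_one (ha : 0 < a) : ecc a 1 = 1 := by
  rw [ecc, disc_one ha]
  field_simp
  ring

theorem endSinh_sq (ha : 0 < a) (hc : -1 < c) : endSinh a c ^ 2 = endCosh a c ^ 2 - 1 :=
  sq_sqrt (by nlinarith [one_lt_endCosh ha hc])

theorem endSinh_pos (ha : 0 < a) (hc : -1 < c) : 0 < endSinh a c :=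
  sqrt_pos.mpr (by nlinarith [one_lt_endCosh ha hc])

theorem sinh_endAnomaly (ha : 0 < a) (hc : -1 < c) : sinh (endAnomaly a c) = endSinh a c :=
  sinh_arcosh (one_lt_endCosh ha hc).le

theorem cosh_endAnomaly (ha : 0 < a) (hc : -1 < c) : cosh (endAnomaly a c) = endCosh a c :=
  cosh_arcosh (one_lt_endCosh ha hc).le

theorem endAnomaly_pos (ha : 0 < a) (hc : -1 < c) : 0 < endAnomaly a c :=
  arcosh_pos (one_lt_endCosh ha hc)

theorem endMean_pos (ha : 0 < a) (hc0 : -1 < c) (hc : c ≤ 1) : 0 < endMean a c := by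
  have hu := endAnomaly_pos ha hc0
  exact (by positivity : 0 < endAnomaly a c ^ 3 / 6).trans_le
    (cube_le_kepler (one_le_ecc ha hc) hu.le)

/-- Both sides are the square of the semi-minor axis. -/
theorem one_sub_sq_div_endSinh_sq (ha : 0 < a) (hc : -1 < c) :
    (1 - c ^ 2) / endSinh a c ^ 2 = a ^ 2 * (ecc a c ^ 2 - 1) := by
  rw [div_eq_iff (pow_ne_zero 2 (endSinh_pos ha hc).ne'), endSinh_sq ha hc]
  linear_combination (a * (endCosh a c - ecc a c) + c) * endCosh_sub_ecc ha c -
    (a * (ecc a c * endCosh a c) + (1 - a)) * ecc_mul_endCosh ha c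

theorem eq_endCosh (ha : 0 < a) {x : ℝ} (hx : 0 < x) (h : a * x ^ 2 - c * x = a + 1) :
    x = endCosh a c := by
  have hfactor : a * ((x - endCosh a c) * (x + ecc a c)) = 0 := by
    linear_combination h - ecc_mul_endCosh ha c - x * endCosh_sub_ecc ha c
  have hne : x + ecc a c ≠ 0 := (add_pos hx (ecc_pos ha c)).ne'
  simpa [ha.ne', hne, sub_eq_zero] using hfactor

theorem contDiffAt_disc (ha : 0 < a) (c : ℝ) : ContDiffAt ℝ 1 (disc a) c :=
  ContDiffAt.sqrt (by fun_prop) (by positivity)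

theorem contDiffAt_ecc (ha : 0 < a) (c : ℝ) : ContDiffAt ℝ 1 (ecc a) c :=
  ((contDiffAt_disc ha c).sub contDiffAt_id).div_const _

theorem contDiffAt_endCosh (ha : 0 < a) (c : ℝ) : ContDiffAt ℝ 1 (endCosh a) c :=
  ((contDiffAt_disc ha c).add contDiffAt_id).div_const _

theorem contDiffAt_endSinh (ha : 0 < a) (hc : -1 < c) : ContDiffAt ℝ 1 (endSinh a) c :=
  (((contDiffAt_endCosh ha c).pow 2).sub contDiffAt_const).sqrt
    (by nlinarith [one_lt_endCosh ha hc])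

theorem contDiffAt_endAnomaly (ha : 0 < a) (hc : -1 < c) : ContDiffAt ℝ 1 (endAnomaly a) c :=
  (contDiffAt_arcosh (one_lt_endCosh ha hc)).comp c (contDiffAt_endCosh ha c)

theorem contDiffAt_endMean (ha : 0 < a) (hc : -1 < c) : ContDiffAt ℝ 1 (endMean a) c :=
  ((contDiffAt_ecc ha c).mul (contDiffAt_endAnomaly ha hc).sinh).sub (contDiffAt_endAnomaly ha hc)

theorem hasDerivAt_disc (ha : 0 < a) (c : ℝ) : HasDerivAt (disc a) (c / disc a c) c := by
  have hradicand : HasDerivAt (fun c : ℝ => c ^ 2 + 4 * a ^ 2 + 4 * a) (2 * c) c := by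
    simpa using ((hasDerivAt_pow 2 c).add_const (4 * a ^ 2)).add_const (4 * a)
  exact (hradicand.sqrt (by positivity)).congr_deriv (mul_div_mul_left c _ two_ne_zero)

theorem hasDerivAt_ecc (ha : 0 < a) (c : ℝ) : HasDerivAt (ecc a) (-ecc a c / disc a c) c := by
  have := disc_pos ha c
  refine (((hasDerivAt_disc ha c).sub (hasDerivAt_id c)).div_const (2 * a)).congr_deriv ?_
  rw [ecc]
  field_simp
  ring

theorem hasDerivAt_endCosh (ha : 0 < a) (c : ℝ) :
    HasDerivAt (endCosh a) (endCosh a c / disc a c) c := by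
  have := disc_pos ha c
  refine (((hasDerivAt_disc ha c).add (hasDerivAt_id c)).div_const (2 * a)).congr_deriv ?_
  rw [endCosh]
  field_simp
  ring

theorem hasDerivAt_endMean (ha : 0 < a) (hc : -1 < c) :
    HasDerivAt (endMean a) (-(c / (a * disc a c * endSinh a c))) c := by
  have hdisc := disc_pos ha c
  have hsinh := endSinh_pos ha hc
  have hanomaly : HasDerivAt (endAnomaly a) ((endSinh a c)⁻¹ * (endCosh a c / disc a c)) c :=
    (hasDerivAt_arcosh (one_lt_endCosh ha hc)).comp c (hasDerivAt_endCosh ha c)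
  refine (((hasDerivAt_ecc ha c).mul hanomaly.sinh).sub hanomaly).congr_deriv ?_
  rw [sinh_endAnomaly ha hc, cosh_endAnomaly ha hc]
  field_simp
  linear_combination (-a * ecc a c) * endSinh_sq ha hc - endCosh_sub_ecc ha c

end Elements

/-! ### The orbits in the frame of their axis -/

/-- The component along the axis of a point of the unit circle with transversal component `δ`. -/
noncomputable def axial (δ : ℝ) : ℝ := √(1 - δ ^ 2)

/-- The semi-minor axis, with the sign of `δ`, of the orbit with end points `axial δ ± δ i`. -/
noncomputable def semiminor (a δ : ℝ) : ℝ := δ / endSinh a (axial δ)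

/-- The position with eccentric anomaly `u` on the orbit with end points `axial δ ± δ i`. -/
noncomputable def framePoint (a δ u : ℝ) : ℂ :=
  ((a * (cosh u - ecc a (axial δ)) : ℝ) : ℂ) + ((semiminor a δ * sinh u : ℝ) : ℂ) * Complex.I

/-- The eccentric anomaly at time `s` on the orbit with mean motion `n`. -/
noncomputable def anomaly (a n δ s : ℝ) : ℝ :=
  keplerInv (ecc a (axial δ)) (n * s - endMean a (axial δ))

/-- The position at time `s` on the orbit with mean motion `n`. -/
noncomputable def frameOrbit (a n δ s : ℝ) : ℂ := framePoint a δ (anomaly a n δ s)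

section Frame

variable {a n δ : ℝ}

theorem axial_sq (hδ : δ ^ 2 < 1) : axial δ ^ 2 = 1 - δ ^ 2 := sq_sqrt (by linarith)

theorem axial_nonneg (δ : ℝ) : 0 ≤ axial δ := sqrt_nonneg _

theorem axial_pos (hδ : δ ^ 2 < 1) : 0 < axial δ := sqrt_pos.mpr (by linarith)

theorem neg_one_lt_axial (δ : ℝ) : -1 < axial δ := by linarith [axial_nonneg δ]

theorem axial_le_one (δ : ℝ) : axial δ ≤ 1 := sqrt_le_one.mpr (by linarith [sq_nonneg δ])

theorem axial_lt_one (hδ : δ ≠ 0) : axial δ < 1 :=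
  (sqrt_lt' one_pos).mpr (by linarith [pow_pos (abs_pos.mpr hδ) 2, sq_abs δ])

theorem axial_zero : axial 0 = 1 := by simp [axial]

theorem contDiffAt_axial (hδ : δ ^ 2 < 1) : ContDiffAt ℝ 1 axial δ :=
  ContDiffAt.sqrt (by fun_prop) (by linarith)

theorem contDiffAt_ecc_axial (ha : 0 < a) (hδ : δ ^ 2 < 1) :
    ContDiffAt ℝ 1 (fun δ => ecc a (axial δ)) δ :=
  (contDiffAt_ecc ha _).comp δ (contDiffAt_axial hδ)

theorem contDiffAt_endMean_axial (ha : 0 < a) (hδ : δ ^ 2 < 1) :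
    ContDiffAt ℝ 1 (fun δ => endMean a (axial δ)) δ :=
  ContDiffAt.comp (g := endMean a) δ (contDiffAt_endMean ha (neg_one_lt_axial δ))
    (contDiffAt_axial hδ)

theorem contDiffAt_semiminor (ha : 0 < a) (hδ : δ ^ 2 < 1) : ContDiffAt ℝ 1 (semiminor a) δ :=
  contDiffAt_id.div (ContDiffAt.comp (g := endSinh a) δ (contDiffAt_endSinh ha (neg_one_lt_axial δ))
    (contDiffAt_axial hδ)) (endSinh_pos ha (neg_one_lt_axial δ)).ne'

theorem one_le_ecc_axial (ha : 0 < a) (δ : ℝ) : 1 ≤ ecc a (axial δ) :=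
  one_le_ecc ha (axial_le_one δ)

theorem semiminor_zero (a : ℝ) : semiminor a 0 = 0 := zero_div _

theorem semiminor_sq (ha : 0 < a) (hδ : δ ^ 2 < 1) :
    semiminor a δ ^ 2 = a ^ 2 * (ecc a (axial δ) ^ 2 - 1) := by
  rw [← one_sub_sq_div_endSinh_sq ha (neg_one_lt_axial δ), axial_sq hδ, semiminor, div_pow,
    sub_sub_cancel]

theorem norm_framePoint (ha : 0 < a) (hδ : δ ^ 2 < 1) (u : ℝ) :
    ‖framePoint a δ u‖ = a * (ecc a (axial δ) * cosh u - 1) := by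
  have hnonneg : 0 ≤ a * (ecc a (axial δ) * cosh u - 1) :=
    mul_nonneg ha.le (by nlinarith [one_le_ecc_axial ha δ, one_le_cosh u])
  rw [framePoint, Complex.norm_add_mul_I, ← sqrt_sq hnonneg]
  congr 1
  rw [mul_pow (semiminor a δ), semiminor_sq ha hδ, sinh_sq]
  ring

theorem framePoint_ne_zero_iff (ha : 0 < a) (hδ : δ ^ 2 < 1) (u : ℝ) :
    framePoint a δ u ≠ 0 ↔ ecc a (axial δ) * cosh u - 1 ≠ 0 := by
  rw [← norm_ne_zero_iff, norm_framePoint ha hδ]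
  simp [ha.ne']

theorem framePoint_eq_zero_iff (ha : 0 < a) (hδ : δ ^ 2 < 1) (u : ℝ) :
    framePoint a δ u = 0 ↔ δ = 0 ∧ u = 0 := by
  rw [← not_iff_not, ← ne_eq, framePoint_ne_zero_iff ha hδ, not_iff_not]
  refine ⟨fun h => ?_, fun ⟨h1, h2⟩ => by rw [h1, h2, axial_zero, ecc_one ha, cosh_zero]; norm_num⟩
  have hε := one_le_ecc_axial ha δ
  have hcosh := one_le_cosh u
  constructor
  · by_contra hne
    nlinarith [one_lt_ecc ha (axial_lt_one hne)]
  · by_contra hne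
    nlinarith [one_lt_cosh.mpr hne]

theorem kepler_anomaly (ha : 0 < a) (n δ s : ℝ) :
    kepler (ecc a (axial δ)) (anomaly a n δ s) = n * s - endMean a (axial δ) :=
  kepler_keplerInv (one_le_ecc_axial ha δ) _

theorem contDiffAt_framePoint {X : Type*} [NormedAddCommGroup X] [NormedSpace ℝ X] {d u : X → ℝ}
    {x : X} (ha : 0 < a) (hd : ContDiffAt ℝ 1 d x) (hu : ContDiffAt ℝ 1 u x) (hδ : d x ^ 2 < 1) :
    ContDiffAt ℝ 1 (fun y => framePoint a (d y) (u y)) x := by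
  have hofReal : ContDiff ℝ 1 (fun t : ℝ => (t : ℂ)) := Complex.ofRealCLM.contDiff
  have hre : ContDiffAt ℝ 1 (fun y => a * (cosh (u y) - ecc a (axial (d y)))) x :=
    contDiffAt_const.mul (hu.cosh.sub ((contDiffAt_ecc_axial ha hδ).comp x hd))
  have him : ContDiffAt ℝ 1 (fun y => semiminor a (d y) * sinh (u y)) x :=
    ((contDiffAt_semiminor ha hδ).comp x hd).mul hu.sinh
  exact (hofReal.contDiffAt.comp x hre).add ((hofReal.contDiffAt.comp x him).mul contDiffAt_const)

theorem contDiffAt_anomaly {X : Type*} [NormedAddCommGroup X] [NormedSpace ℝ X] {d t : X → ℝ}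
    {x : X} (ha : 0 < a) (hd : ContDiffAt ℝ 1 d x) (ht : ContDiffAt ℝ 1 t x) (hδ : d x ^ 2 < 1)
    (h : frameOrbit a n (d x) (t x) ≠ 0) :
    ContDiffAt ℝ 1 (fun y => anomaly a n (d y) (t y)) x :=
  contDiffAt_keplerInv ((contDiffAt_ecc_axial ha hδ).comp x hd)
    ((contDiffAt_const.mul ht).sub ((contDiffAt_endMean_axial ha hδ).comp x hd))
    (Eventually.of_forall fun _ => one_le_ecc_axial ha _) ((framePoint_ne_zero_iff ha hδ _).mp h)

theorem contDiffAt_frameOrbit {X : Type*} [NormedAddCommGroup X] [NormedSpace ℝ X] {d t : X → ℝ}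
    {x : X} (ha : 0 < a) (hd : ContDiffAt ℝ 1 d x) (ht : ContDiffAt ℝ 1 t x) (hδ : d x ^ 2 < 1)
    (h : frameOrbit a n (d x) (t x) ≠ 0) :
    ContDiffAt ℝ 1 (fun y => frameOrbit a n (d y) (t y)) x :=
  contDiffAt_framePoint ha hd (contDiffAt_anomaly ha hd ht hδ h) hδ

theorem tendsto_anomaly {X : Type*} {l : Filter X} {d t : X → ℝ} {t₀ : ℝ}
    (ha : 0 < a) (hd : Tendsto d l (𝓝 δ)) (ht : Tendsto t l (𝓝 t₀)) (hδ : δ ^ 2 < 1) :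
    Tendsto (fun y => anomaly a n (d y) (t y)) l (𝓝 (anomaly a n δ t₀)) :=
  tendsto_keplerInv (one_le_ecc_axial ha δ)
    ((contDiffAt_ecc_axial ha hδ).continuousAt.tendsto.comp hd)
    ((ht.const_mul n).sub ((contDiffAt_endMean_axial ha hδ).continuousAt.tendsto.comp hd))
    (Eventually.of_forall fun _ => one_le_ecc_axial ha _)

theorem tendsto_framePoint {X : Type*} {l : Filter X} {d u : X → ℝ} {u₀ : ℝ}
    (ha : 0 < a) (hd : Tendsto d l (𝓝 δ)) (hu : Tendsto u l (𝓝 u₀)) (hδ : δ ^ 2 < 1) :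
    Tendsto (fun y => framePoint a (d y) (u y)) l (𝓝 (framePoint a δ u₀)) := by
  have hpair : Tendsto (fun y => (d y, u y)) l (𝓝 (δ, u₀)) := hd.prodMk_nhds hu
  have hpoint : ContinuousAt (fun p : ℝ × ℝ => framePoint a p.1 p.2) (δ, u₀) :=
    (contDiffAt_framePoint (x := (δ, u₀)) (d := Prod.fst) (u := Prod.snd) ha contDiffAt_fst
      contDiffAt_snd hδ).continuousAt
  simpa only [Function.comp_def] using hpoint.tendsto.comp hpair

theorem tendsto_frameOrbit {X : Type*} {l : Filter X} {d t : X → ℝ} {t₀ : ℝ}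
    (ha : 0 < a) (hd : Tendsto d l (𝓝 δ)) (ht : Tendsto t l (𝓝 t₀)) (hδ : δ ^ 2 < 1) :
    Tendsto (fun y => frameOrbit a n (d y) (t y)) l (𝓝 (frameOrbit a n δ t₀)) :=
  tendsto_framePoint ha hd (tendsto_anomaly ha hd ht hδ) hδ

end Frame

/-! ### Differentiability with respect to the end points at the collision -/

theorem contDiffAt_of_tendsto_deriv_zero {F : Type*} [NormedAddCommGroup F] [NormedSpace ℝ F]
    {f : ℝ → F} {x : ℝ} (hf : ContinuousAt f x)
    (hd : ∀ᶠ y in 𝓝[≠] x, ContDiffAt ℝ 1 f y) (hl : Tendsto (deriv f) (𝓝[≠] x) (𝓝 0)) :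
    ContDiffAt ℝ 1 f x := by
  have hmem : {y | DifferentiableAt ℝ f y} ∈ 𝓝[≠] x :=
    hd.mono fun y hy => hy.differentiableAt one_ne_zero
  have hdiff : DifferentiableOn ℝ f {y | DifferentiableAt ℝ f y} :=
    fun y hy => DifferentiableAt.differentiableWithinAt hy
  have hright : HasDerivWithinAt f 0 (Ici x) x :=
    hasDerivWithinAt_Ici_of_tendsto_deriv hdiff hf.continuousWithinAt
      (nhdsGT_le_nhdsNE x hmem) (hl.mono_left (nhdsGT_le_nhdsNE x))
  have hleft : HasDerivWithinAt f 0 (Iic x) x :=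
    hasDerivWithinAt_Iic_of_tendsto_deriv hdiff hf.continuousWithinAt
      (nhdsLT_le_nhdsNE x hmem) (hl.mono_left (nhdsLT_le_nhdsNE x))
  have hderiv : HasDerivAt f 0 x := by simpa using hleft.union hright
  let f' (y : ℝ) : ℝ →L[ℝ] F := .toSpanSingleton ℝ (deriv f y)
  have htoSpan : Continuous fun v : F => ContinuousLinearMap.toSpanSingleton ℝ v :=
    (ContinuousLinearMap.toSpanSingletonCLE (𝕜 := ℝ) (E := F)).continuous
  have haway : ∀ᶠ y in 𝓝[≠] x, HasFDerivAt f (f' y) y ∧ ContinuousAt f' y :=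
    hd.mono fun y hy => ⟨(hy.differentiableAt one_ne_zero).hasDerivAt.hasFDerivAt,
      htoSpan.continuousAt.comp (hy.derivWithin (m := 0) (by norm_num)).continuousAt⟩
  have hat : HasFDerivAt f (f' x) x ∧ ContinuousAt f' x := by
    refine ⟨hderiv.differentiableAt.hasDerivAt.hasFDerivAt, htoSpan.continuousAt.comp ?_⟩
    rwa [continuousAt_iff_punctured_nhds, hderiv.deriv]
  have hall : ∀ᶠ y in 𝓝 x, HasFDerivAt f (f' y) y ∧ ContinuousAt f' y := by
    rw [← nhdsNE_sup_pure x]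
    exact eventually_sup.mpr ⟨haway, hat⟩
  exact contDiffAt_one_iff.mpr ⟨f', _, hall, fun y hy => hy.2.continuousWithinAt,
    fun y hy => hy.1⟩

section Asymptotics

open Asymptotics

variable {α : Type*} {l : Filter α}

theorem isBigO_of_mul_left {f g k : α → ℝ} (hk : ∀ᶠ x in l, k x ≠ 0)
    (h : (fun x => k x * f x) =O[l] fun x => k x * g x) : f =O[l] g := by
  refine ((isBigO_refl (fun x => (k x)⁻¹) l).mul h).congr' ?_ ?_ <;>
  exact hk.mono fun x hx => inv_mul_cancel_left₀ hx _

theorem isBigO_cube_of_kepler_eq {ε M u g : α → ℝ} (hk : ∀ x, kepler (ε x) (u x) = M x)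
    (hu : Tendsto u l (𝓝 0)) (hε : (fun x => ε x - 1) =O[l] g) (hM : g =O[l] M) :
    g =O[l] fun x => u x ^ 3 := by
  have hsinh : Tendsto (fun x => sinh (u x)) l (𝓝 0) := by
    simpa only [sinh_zero, Function.comp_def] using (continuous_sinh.tendsto 0).comp hu
  have hperturbation : (fun x => (ε x - 1) * sinh (u x)) =o[l] M := by
    simpa using (hε.mul_isLittleO ((isLittleO_one_iff ℝ).mpr hsinh)).trans_isBigO
      (by simpa using hM)
  have hcube : (fun x => kepler 1 (u x)) =O[l] fun x => u x ^ 3 := by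
    refine .of_bound 1 ?_
    filter_upwards [hu.eventually (eventually_abs_sub_lt 0 one_pos)] with x hx
    simpa using abs_kepler_one_le (u := u x) (by simpa using hx.le)
  refine hM.trans (hperturbation.right_isBigO_sub.trans (hcube.congr_left fun x => ?_))
  rw [← hk x]
  simp only [kepler]
  ring

/-- The hypothesis `hk'` is Kepler's equation differentiated along a family of orbits. -/
theorem sq_mul_isBigO_of_kepler_deriv {ε u ε' M' u' g : α → ℝ} (h1 : ∀ x, 1 ≤ ε x)
    (hu : Tendsto u l (𝓝 0)) (hε' : ε' =O[l] g) (hM' : M' =O[l] g)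
    (hk' : ∀ᶠ x in l, ε' x * sinh (u x) + (ε x * cosh (u x) - 1) * u' x = M' x) :
    (fun x => u x ^ 2 * u' x) =O[l] g := by
  have hcoeff (x : α) : u x ^ 2 / 2 ≤ ε x * cosh (u x) - 1 := by
    nlinarith [one_add_sq_div_two_le_cosh (u x), h1 x, one_le_cosh (u x)]
  have hsinh : (fun x => sinh (u x)) =O[l] fun _ => (1 : ℝ) :=
    ((continuous_sinh.tendsto 0).comp hu).isBigO_one ℝ
  have hrhs : (fun x => M' x - ε' x * sinh (u x)) =O[l] g :=
    hM'.sub (by simpa using hε'.mul hsinh)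
  refine (IsBigO.of_bound 2 ?_).trans hrhs
  filter_upwards [hk'] with x hx
  have hprod : M' x - ε' x * sinh (u x) = (ε x * cosh (u x) - 1) * u' x := by linarith
  rw [hprod, norm_mul, norm_mul, ← mul_assoc]
  gcongr
  rw [norm_of_nonneg (sq_nonneg _), norm_of_nonneg (le_trans (by positivity) (hcoeff x))]
  linarith [hcoeff x]

/-- Near the collision `u` is of order `δ ^ (2 / 3)`. -/
theorem tendsto_zero_of_isBigO_cube {δ u u' : α → ℝ} (hδ : ∀ᶠ x in l, δ x ≠ 0)
    (hu : Tendsto u l (𝓝 0)) (hcube : (fun x => δ x ^ 2) =O[l] fun x => u x ^ 3)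
    (hsq : (fun x => u x ^ 2 * u' x) =O[l] δ) :
    Tendsto (fun x => sinh (u x) * u' x) l (𝓝 0) ∧ Tendsto (fun x => δ x * u' x) l (𝓝 0) := by
  have hu0 : ∀ᶠ x in l, u x ^ 2 ≠ 0 := by
    filter_upwards [hδ, hcube.eq_zero_imp] with x hx himp h
    exact hx (by simpa using himp (by simpa using h))
  have hcube' : (fun x => δ x ^ 2) =O[l] fun x => u x ^ 2 * u x := by
    simpa only [← pow_succ] using hcube
  have hprod : (fun x => (u x * u' x) ^ 2) =O[l] u := by
    refine isBigO_of_mul_left hu0 (((hsq.pow 2).trans hcube').congr_left fun x => ?_)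
    ring
  have hδu' : (fun x => δ x * u' x) =O[l] u := by
    refine isBigO_of_mul_left hu0 ?_
    refine (((isBigO_refl δ l).mul hsq).congr (fun x => ?_) fun x => (sq (δ x)).symm).trans hcube'
    ring
  have hlim : Tendsto (fun x => u x * u' x) l (𝓝 0) :=
    tendsto_zero_of_abs_pow two_ne_zero (by simpa only [sq_abs] using hprod.trans_tendsto hu)
  have hsinh : (fun x => sinh (u x)) =O[l] u := isEquivalent_sinh.isBigO.comp_tendsto hu
  exact ⟨(hsinh.mul (isBigO_refl u' l)).trans_tendsto hlim, hδu'.trans_tendsto hu⟩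

end Asymptotics

section FixedTime

open Asymptotics

theorem eventually_sq_lt_one : ∀ᶠ δ in 𝓝 (0 : ℝ), δ ^ 2 < 1 :=
  (continuous_pow 2).continuousAt.eventually (gt_mem_nhds (by norm_num))

theorem tendsto_axial_zero : Tendsto axial (𝓝 0) (𝓝 1) := by
  simpa only [axial_zero] using (contDiffAt_axial (δ := 0) (by norm_num)).continuousAt.tendsto

theorem hasDerivAt_axial {δ : ℝ} (hδ : δ ^ 2 < 1) : HasDerivAt axial (-δ / axial δ) δ := by
  have hradicand : HasDerivAt (fun δ : ℝ => 1 - δ ^ 2) (-(2 * δ)) δ := by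
    simpa using (hasDerivAt_pow 2 δ).const_sub 1
  refine (hradicand.sqrt (by linarith)).congr_deriv ?_
  rw [← mul_neg, mul_div_mul_left _ _ two_ne_zero, axial]

theorem axial_sub_one_isTheta : (fun δ => axial δ - 1) =Θ[𝓝 0] fun δ : ℝ => δ ^ 2 := by
  have hbounds : ∀ᶠ δ in 𝓝 (0 : ℝ), δ ^ 2 / 2 ≤ 1 - axial δ ∧ 1 - axial δ ≤ δ ^ 2 := by
    filter_upwards [eventually_sq_lt_one] with δ hδ
    constructor <;> nlinarith [axial_sq hδ, axial_nonneg δ, axial_le_one δ]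
  constructor
  · refine .of_bound 1 (hbounds.mono fun δ h => ?_)
    rw [norm_sub_rev, norm_of_nonneg (sub_nonneg.mpr (axial_le_one δ)),
      norm_of_nonneg (sq_nonneg δ)]
    linarith [h.2]
  · refine .of_bound 2 (hbounds.mono fun δ h => ?_)
    rw [norm_sub_rev, norm_of_nonneg (sub_nonneg.mpr (axial_le_one δ)),
      norm_of_nonneg (sq_nonneg δ)]
    linarith [h.1]

theorem comp_axial_sub_isBigO {G : ℝ → ℝ} (hG : DifferentiableAt ℝ G 1) :
    (fun δ => G (axial δ) - G 1) =O[𝓝 0] fun δ => δ ^ 2 :=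
  (hG.isBigO_sub.comp_tendsto tendsto_axial_zero).trans axial_sub_one_isTheta.isBigO

theorem sq_isBigO_comp_axial_sub {G : ℝ → ℝ} {G' : ℝ} (hG : HasDerivAt G G' 1) (hG' : G' ≠ 0) :
    (fun δ => δ ^ 2) =O[𝓝 0] fun δ => G (axial δ) - G 1 := by
  have hlin : (fun c => c - 1) =O[𝓝 1] fun c => G c - G 1 :=
    (HasDerivAtFilter.isTheta_sub hG hG').isBigO_symm.comp_tendsto (k := fun c : ℝ => (c, (1 : ℝ)))
      (tendsto_id.prodMk (tendsto_pure.mpr (Eventually.of_forall fun _ => rfl)))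
  exact axial_sub_one_isTheta.isBigO_symm.trans (hlin.comp_tendsto tendsto_axial_zero)

theorem deriv_comp_axial_isBigO {G : ℝ → ℝ} (hG : ContDiffAt ℝ 1 G 1) :
    deriv (fun δ => G (axial δ)) =O[𝓝 0] fun δ => δ := by
  have hG' : (fun δ => deriv G (axial δ)) =O[𝓝 0] fun _ => (1 : ℝ) :=
    ((hG.derivWithin (m := 0) (by norm_num)).continuousAt.tendsto.comp
      tendsto_axial_zero).isBigO_one ℝ
  have haxial : (fun δ => -δ / axial δ) =O[𝓝 0] fun δ => δ := by
    simpa only [div_eq_mul_inv, mul_one] using (isBigO_refl (fun δ : ℝ => δ) (𝓝 0)).neg_left.mul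
      ((tendsto_axial_zero.inv₀ one_ne_zero).isBigO_one ℝ)
  refine ((hG'.mul haxial).congr' ?_ (by simp))
  filter_upwards [tendsto_axial_zero.eventually (hG.eventually (by simp)), eventually_sq_lt_one]
    with δ hGδ hδ
  exact ((hGδ.differentiableAt one_ne_zero).hasDerivAt.comp δ (hasDerivAt_axial hδ)).deriv.symm

variable {a n s δ : ℝ}

theorem contDiffAt_anomaly_fixed_time (ha : 0 < a) (hδ : δ ^ 2 < 1)
    (h : frameOrbit a n δ s ≠ 0) : ContDiffAt ℝ 1 (fun δ => anomaly a n δ s) δ :=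
  contDiffAt_anomaly (d := id) (t := fun _ => s) ha contDiffAt_id contDiffAt_const hδ h

theorem frameOrbit_ne_zero (ha : 0 < a) (hδ : δ ^ 2 < 1) (h0 : δ ≠ 0) (s : ℝ) :
    frameOrbit a n δ s ≠ 0 :=
  fun h => h0 ((framePoint_eq_zero_iff ha hδ _).mp h).1

theorem eventually_sq_lt_one_and_ne_zero : ∀ᶠ δ in 𝓝[≠] (0 : ℝ), δ ^ 2 < 1 ∧ δ ≠ 0 :=
  (eventually_sq_lt_one.filter_mono nhdsWithin_le_nhds).and self_mem_nhdsWithin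

theorem tendsto_anomaly_collision (ha : 0 < a) (hs : n * s = endMean a 1) :
    Tendsto (fun δ => anomaly a n δ s) (𝓝 0) (𝓝 0) := by
  have hzero : anomaly a n 0 s = 0 := by
    rw [anomaly, keplerInv_eq_iff (one_le_ecc_axial ha 0), axial_zero, hs, sub_self, kepler_zero]
  simpa only [hzero, id] using tendsto_anomaly (n := n) (δ := 0) ha tendsto_id
    (tendsto_const_nhds (x := s)) (by norm_num)

theorem deriv_kepler_anomaly (ha : 0 < a) (hδ : δ ^ 2 < 1) (h : frameOrbit a n δ s ≠ 0) :
    deriv (fun δ => ecc a (axial δ)) δ * sinh (anomaly a n δ s) +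
      (ecc a (axial δ) * cosh (anomaly a n δ s) - 1) * deriv (fun δ => anomaly a n δ s) δ =
        -deriv (fun δ => endMean a (axial δ)) δ := by
  have hε := ((contDiffAt_ecc_axial ha hδ).differentiableAt one_ne_zero).hasDerivAt
  have hM := ((contDiffAt_endMean_axial ha hδ).differentiableAt one_ne_zero).hasDerivAt
  have hu := ((contDiffAt_anomaly_fixed_time ha hδ h).differentiableAt one_ne_zero).hasDerivAt
  have hkepler := (hε.mul hu.sinh).sub hu
  have hequation : ((fun δ => ecc a (axial δ)) * fun δ => sinh (anomaly a n δ s)) -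
      (fun δ => anomaly a n δ s) = fun δ => n * s - endMean a (axial δ) :=
    funext fun δ => kepler_anomaly ha n δ s
  rw [hequation] at hkepler
  linear_combination hkepler.unique (hM.const_sub (n * s))

theorem tendsto_deriv_anomaly_collision (ha : 0 < a) (hs : n * s = endMean a 1) :
    Tendsto (fun δ => sinh (anomaly a n δ s) * deriv (fun δ => anomaly a n δ s) δ)
      (𝓝[≠] 0) (𝓝 0) ∧
    Tendsto (fun δ => δ * deriv (fun δ => anomaly a n δ s) δ) (𝓝[≠] 0) (𝓝 0) := by
  have hle : 𝓝[≠] (0 : ℝ) ≤ 𝓝 0 := nhdsWithin_le_nhds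
  have hu := (tendsto_anomaly_collision ha hs).mono_left hle
  have hε : (fun δ => ecc a (axial δ) - 1) =O[𝓝 0] fun δ => δ ^ 2 := by
    simpa only [ecc_one ha] using comp_axial_sub_isBigO (hasDerivAt_ecc ha 1).differentiableAt
  have hslope : -(1 / (a * disc a 1 * endSinh a 1)) ≠ 0 :=
    neg_ne_zero.mpr (one_div_pos.mpr (mul_pos (mul_pos ha (disc_pos ha 1))
      (endSinh_pos ha (by norm_num)))).ne'
  have hM : (fun δ => δ ^ 2) =O[𝓝 0] fun δ => n * s - endMean a (axial δ) := by
    simpa only [hs, neg_sub] using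
      (sq_isBigO_comp_axial_sub (hasDerivAt_endMean ha (by norm_num)) hslope).neg_right
  have hcube := isBigO_cube_of_kepler_eq (fun δ => kepler_anomaly ha n δ s) hu (hε.mono hle)
    (hM.mono hle)
  have hsq := sq_mul_isBigO_of_kepler_deriv (fun δ => one_le_ecc_axial ha δ) hu
    ((deriv_comp_axial_isBigO (contDiffAt_ecc ha 1)).mono hle)
    ((deriv_comp_axial_isBigO (contDiffAt_endMean ha (by norm_num))).neg_left.mono hle)
    (eventually_sq_lt_one_and_ne_zero.mono fun δ hδ =>
      deriv_kepler_anomaly ha hδ.1 (frameOrbit_ne_zero ha hδ.1 hδ.2 s))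
  exact tendsto_zero_of_isBigO_cube self_mem_nhdsWithin hu hcube hsq

theorem deriv_frameOrbit (ha : 0 < a) (hδ : δ ^ 2 < 1) (h : frameOrbit a n δ s ≠ 0) :
    deriv (fun δ => frameOrbit a n δ s) δ =
      ((a * (sinh (anomaly a n δ s) * deriv (fun δ => anomaly a n δ s) δ -
        deriv (fun δ => ecc a (axial δ)) δ) : ℝ) : ℂ) +
      ((deriv (semiminor a) δ * sinh (anomaly a n δ s) + semiminor a δ *
        (cosh (anomaly a n δ s) * deriv (fun δ => anomaly a n δ s) δ) : ℝ) : ℂ) * Complex.I := by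
  have hε := ((contDiffAt_ecc_axial ha hδ).differentiableAt one_ne_zero).hasDerivAt
  have hu := ((contDiffAt_anomaly_fixed_time ha hδ h).differentiableAt one_ne_zero).hasDerivAt
  have hb := ((contDiffAt_semiminor ha hδ).differentiableAt one_ne_zero).hasDerivAt
  exact ((((hu.cosh.sub hε).const_mul a).ofReal_comp).add
    ((hb.mul hu.sinh).ofReal_comp.mul_const Complex.I)).deriv

theorem tendsto_deriv_frameOrbit_collision (ha : 0 < a) (hs : n * s = endMean a 1) :
    Tendsto (deriv fun δ => frameOrbit a n δ s) (𝓝[≠] 0) (𝓝 0) := by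
  have hle : 𝓝[≠] (0 : ℝ) ≤ 𝓝 0 := nhdsWithin_le_nhds
  have h0 : (0 : ℝ) ^ 2 < 1 := by norm_num
  obtain ⟨hsinh_mul, hδ_mul⟩ := tendsto_deriv_anomaly_collision ha hs
  have hu := (tendsto_anomaly_collision ha hs).mono_left hle
  have hsinh := (continuous_sinh.tendsto 0).comp hu
  have hcosh := (continuous_cosh.tendsto 0).comp hu
  have hε' := (deriv_comp_axial_isBigO (contDiffAt_ecc ha 1)).trans_tendsto tendsto_id
  have hb := contDiffAt_semiminor ha h0
  have hb' := (hb.derivWithin (m := 0) (by norm_num)).continuousAt.tendsto.mono_left hle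
  have hendSinh : Tendsto (fun δ => (endSinh a (axial δ))⁻¹) (𝓝[≠] 0) (𝓝 (endSinh a 1)⁻¹) :=
    (((contDiffAt_endSinh ha (by norm_num)).continuousAt.tendsto.comp tendsto_axial_zero).inv₀
      (endSinh_pos ha (by norm_num)).ne').mono_left hle
  have hre := (hsinh_mul.sub (hε'.mono_left hle)).const_mul a
  have him := (hb'.mul hsinh).add ((hendSinh.mul hcosh).mul hδ_mul)
  rw [sub_zero, mul_zero] at hre
  rw [sinh_zero, mul_zero, mul_zero, add_zero] at him
  have hlim := ((Complex.continuous_ofReal.tendsto 0).comp hre).add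
    (((Complex.continuous_ofReal.tendsto 0).comp him).mul_const Complex.I)
  simp only [Complex.ofReal_zero, zero_mul, add_zero] at hlim
  refine hlim.congr' (eventually_sq_lt_one_and_ne_zero.mono fun δ hδ => ?_)
  rw [deriv_frameOrbit ha hδ.1 (frameOrbit_ne_zero ha hδ.1 hδ.2 s)]
  simp only [Function.comp_apply, semiminor]
  congr 3
  ring

theorem contDiffAt_frameOrbit_fixed_time (ha : 0 < a) (hδ : δ ^ 2 < 1) (s : ℝ) :
    ContDiffAt ℝ 1 (fun δ => frameOrbit a n δ s) δ := by
  have haway {δ : ℝ} (hδ : δ ^ 2 < 1) (h : frameOrbit a n δ s ≠ 0) :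
      ContDiffAt ℝ 1 (fun δ => frameOrbit a n δ s) δ :=
    contDiffAt_frameOrbit (d := id) (t := fun _ => s) ha contDiffAt_id contDiffAt_const hδ h
  by_cases hcol : frameOrbit a n δ s = 0
  · obtain ⟨rfl, hu⟩ := (framePoint_eq_zero_iff ha hδ _).mp hcol
    have hs : n * s = endMean a 1 := by
      have := kepler_anomaly ha n 0 s
      rw [hu, kepler_zero, axial_zero] at this
      linarith
    exact contDiffAt_of_tendsto_deriv_zero
      (tendsto_frameOrbit (d := id) (t := fun _ => s) ha tendsto_id tendsto_const_nhds hδ)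
      (eventually_sq_lt_one_and_ne_zero.mono fun δ hδ =>
        haway hδ.1 (frameOrbit_ne_zero ha hδ.1 hδ.2 s))
      (tendsto_deriv_frameOrbit_collision ha hs)
  · exact haway hδ hcol

end FixedTime

/-! ### The axis of a pair of end points -/

/-- The midpoint of the shortest arc of the unit circle between two points: the direction of the
axis of the orbit that joins them. -/
noncomputable def arcMid (p q : ℂ) : ℂ := (p + q) / (‖p + q‖ : ℂ)

/-- The component of `q` transversal to the direction of `arcMid p q`. -/
noncomputable def offset (p q : ℂ) : ℝ := (q * (starRingEnd ℂ) p).im / ‖p + q‖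

/-- The point of the unit circle with transversal component `δ` in the right half-plane. -/
noncomputable def frameEnd (δ : ℝ) : ℂ := (axial δ : ℂ) + (δ : ℂ) * Complex.I

theorem frameEnd_re (δ : ℝ) : (frameEnd δ).re = axial δ := by simp [frameEnd]

theorem frameEnd_im (δ : ℝ) : (frameEnd δ).im = δ := by simp [frameEnd]

theorem conj_frameEnd (δ : ℝ) : (starRingEnd ℂ) (frameEnd δ) = frameEnd (-δ) := by
  simp [frameEnd, axial]

theorem norm_frameEnd {δ : ℝ} (hδ : δ ^ 2 < 1) : ‖frameEnd δ‖ = 1 := by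
  rw [frameEnd, Complex.norm_add_mul_I, axial_sq hδ, sub_add_cancel, sqrt_one]

theorem frameEnd_ne_zero {δ : ℝ} (hδ : δ ^ 2 < 1) : frameEnd δ ≠ 0 :=
  norm_ne_zero_iff.mp (by rw [norm_frameEnd hδ]; exact one_ne_zero)

theorem frameEnd_mul_frameEnd_neg {δ : ℝ} (hδ : δ ^ 2 < 1) : frameEnd δ * frameEnd (-δ) = 1 := by
  simp [← conj_frameEnd, Complex.mul_conj', norm_frameEnd hδ]

theorem frameEnd_of_norm_eq_one {w : ℂ} (hw : ‖w‖ = 1) (hre : 0 ≤ w.re) : frameEnd w.im = w := by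
  have hsq : 1 - w.im ^ 2 = w.re ^ 2 := by
    have hnorm := Complex.sq_norm w
    rw [hw, Complex.normSq_apply] at hnorm
    linarith
  apply Complex.ext
  · rw [frameEnd_re, axial, hsq, sqrt_sq hre]
  · rw [frameEnd_im]

section EndPoints

variable {p q : ℂ}

theorem nonAntipodal_symm (h : NonAntipodal p q) : NonAntipodal q p :=
  ⟨h.2.1, h.1, by rw [norm_sub_rev]; exact h.2.2⟩

theorem nonAntipodal_self (hp : ‖p‖ = 1) : NonAntipodal p p := ⟨hp, hp, by simp⟩

theorem norm_add_sq_of_norm_eq_one (hp : ‖p‖ = 1) (hq : ‖q‖ = 1) :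
    ‖p + q‖ ^ 2 = 4 - ‖p - q‖ ^ 2 := by
  have h := parallelogram_law_with_norm ℝ p q
  rw [hp, hq] at h
  nlinarith

theorem norm_add_pos (h : NonAntipodal p q) : 0 < ‖p + q‖ := by
  have hsum := norm_add_sq_of_norm_eq_one h.1 h.2.1
  have hdiff : ‖p - q‖ ^ 2 < 4 := by nlinarith [h.2.2, norm_nonneg (p - q)]
  have hne : ‖p + q‖ ≠ 0 := fun h0 => by
    rw [h0] at hsum
    linarith
  exact (norm_nonneg _).lt_of_ne' hne

theorem norm_arcMid (h : NonAntipodal p q) : ‖arcMid p q‖ = 1 := by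
  rw [arcMid, norm_div, Complex.norm_real, norm_norm, div_self (norm_add_pos h).ne']

theorem arcMid_ne_zero (h : NonAntipodal p q) : arcMid p q ≠ 0 :=
  norm_ne_zero_iff.mp (by rw [norm_arcMid h]; exact one_ne_zero)

theorem mul_conj_arcMid (hq : ‖q‖ = 1) :
    q * (starRingEnd ℂ) (arcMid p q) = (q * (starRingEnd ℂ) p + 1) / (‖p + q‖ : ℂ) := by
  rw [arcMid, map_div₀, map_add, Complex.conj_ofReal, mul_div_assoc', mul_add,
    Complex.mul_conj' q, hq]
  norm_num

theorem mul_conj_arcMid_re (h : NonAntipodal p q) :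
    (q * (starRingEnd ℂ) (arcMid p q)).re = ‖p + q‖ / 2 := by
  have hpos := norm_add_pos h
  have hexpand : ‖p + q‖ ^ 2 = 2 * ((q * (starRingEnd ℂ) p).re + 1) := by
    rw [add_comm p q, Complex.sq_norm, Complex.normSq_add, Complex.normSq_eq_norm_sq,
      Complex.normSq_eq_norm_sq, h.1, h.2.1]
    ring
  rw [mul_conj_arcMid h.2.1, Complex.div_ofReal_re, Complex.add_re, Complex.one_re]
  field_simp
  linarith

theorem frameEnd_offset (h : NonAntipodal p q) :
    frameEnd (offset p q) = q * (starRingEnd ℂ) (arcMid p q) := by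
  have him : offset p q = (q * (starRingEnd ℂ) (arcMid p q)).im := by
    rw [mul_conj_arcMid h.2.1, Complex.div_ofReal_im, Complex.add_im, Complex.one_im, add_zero,
      offset]
  rw [him]
  refine frameEnd_of_norm_eq_one ?_ ?_
  · rw [norm_mul, Complex.norm_conj, h.2.1, norm_arcMid h, one_mul]
  · rw [mul_conj_arcMid_re h]
    positivity

theorem axial_offset (h : NonAntipodal p q) : axial (offset p q) = ‖p + q‖ / 2 := by
  rw [← frameEnd_re, frameEnd_offset h, mul_conj_arcMid_re h]

theorem axial_offset_eq_axial_half_norm_sub (h : NonAntipodal p q) :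
    axial (offset p q) = axial (‖p - q‖ / 2) := by
  rw [axial_offset h, axial, eq_comm, sqrt_eq_iff_mul_self_eq_of_pos (half_pos (norm_add_pos h))]
  linarith [norm_add_sq_of_norm_eq_one h.1 h.2.1]

theorem offset_sq_lt_one (h : NonAntipodal p q) : offset p q ^ 2 < 1 := by
  have hpos : 0 < √(1 - offset p q ^ 2) := by
    rw [← axial, axial_offset h]
    exact half_pos (norm_add_pos h)
  linarith [sqrt_pos.mp hpos]

theorem arcMid_mul_frameEnd (h : NonAntipodal p q) : arcMid p q * frameEnd (offset p q) = q := by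
  rw [frameEnd_offset h, mul_left_comm, Complex.mul_conj', norm_arcMid h]
  norm_num

theorem arcMid_comm (p q : ℂ) : arcMid q p = arcMid p q := by rw [arcMid, add_comm, ← arcMid]

theorem offset_symm (p q : ℂ) : offset q p = -offset p q := by
  simp only [offset, add_comm q p, Complex.mul_im, Complex.conj_re, Complex.conj_im]
  ring

theorem arcMid_mul_frameEnd_neg (h : NonAntipodal p q) :
    arcMid p q * frameEnd (-offset p q) = p := by
  rw [← offset_symm, ← arcMid_comm, arcMid_mul_frameEnd (nonAntipodal_symm h)]

theorem offset_self (p : ℂ) : offset p p = 0 := by simp [offset, mul_comm]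

theorem arcMid_self (hp : ‖p‖ = 1) : arcMid p p = p := by
  simpa [offset_self, frameEnd, axial_zero] using arcMid_mul_frameEnd (nonAntipodal_self hp)

theorem offset_ne_zero (h : NonAntipodal p q) (hne : p ≠ q) : offset p q ≠ 0 := fun h0 => by
  have hq := arcMid_mul_frameEnd h
  have hp := arcMid_mul_frameEnd_neg h
  rw [h0, neg_zero] at hp
  rw [h0] at hq
  exact hne (hp.symm.trans hq)

end EndPoints

/-! ### The index of a curve between points of the circle -/

theorem abs_arg_frameEnd_lt {δ : ℝ} (hδ : δ ^ 2 < 1) : |Complex.arg (frameEnd δ)| < π / 2 :=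
  Complex.abs_arg_lt_pi_div_two_iff.mpr (Or.inl (by rw [frameEnd_re]; exact axial_pos hδ))

theorem exp_arg_frameEnd {δ : ℝ} (hδ : δ ^ 2 < 1) :
    Complex.exp (Complex.arg (frameEnd δ) * Complex.I) = frameEnd δ := by
  have hpolar := Complex.norm_mul_exp_arg_mul_I (frameEnd δ)
  rwa [norm_frameEnd hδ, Complex.ofReal_one, one_mul] at hpolar

theorem arg_frameEnd_neg_div_frameEnd {δ : ℝ} (hδ : δ ^ 2 < 1) :
    Complex.arg (frameEnd (-δ) / frameEnd δ) = -2 * Complex.arg (frameEnd δ) := by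
  have hquot : frameEnd (-δ) / frameEnd δ =
      Complex.exp (((-2 * Complex.arg (frameEnd δ) : ℝ) : ℂ) * Complex.I) := by
    rw [eq_inv_of_mul_eq_one_right (frameEnd_mul_frameEnd_neg hδ), ← exp_arg_frameEnd hδ,
      ← Complex.exp_neg, ← Complex.exp_sub, exp_arg_frameEnd hδ]
    congr 1
    push_cast
    ring
  rw [hquot, Complex.arg_exp_mul_I, toIocMod_eq_self]
  constructor <;> linarith [abs_lt.mp (abs_arg_frameEnd_lt hδ)]

theorem arg_div_eq {p q : ℂ} (h : NonAntipodal p q) :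
    Complex.arg (p / q) = -2 * Complex.arg (frameEnd (offset p q)) := by
  rw [← arg_frameEnd_neg_div_frameEnd (offset_sq_lt_one h),
    ← mul_div_mul_left (frameEnd (-offset p q)) _ (arcMid_ne_zero h),
    arcMid_mul_frameEnd h, arcMid_mul_frameEnd_neg h]

theorem deriv_shortestArc (p q : ℂ) (t : ℝ) :
    deriv (shortestArc p q) t = shortestArc p q t * (Complex.arg (q / p) * Complex.I) := by
  have hexponent : HasDerivAt (fun t : ℝ => (t : ℂ) * Complex.arg (q / p) * Complex.I)
      (Complex.arg (q / p) * Complex.I) t := by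
    simpa using ((Complex.ofRealCLM.hasDerivAt (x := t)).mul_const
      (Complex.arg (q / p) : ℂ)).mul_const Complex.I
  rw [shortestArc, mul_assoc]
  exact (hexponent.cexp.const_mul p).deriv

theorem integral_shortestArc {p q : ℂ} (hp : p ≠ 0) :
    ∫ t in (0 : ℝ)..1, deriv (shortestArc p q) t / shortestArc p q t =
      Complex.arg (q / p) * Complex.I := by
  have hconst (t : ℝ) : deriv (shortestArc p q) t / shortestArc p q t =
      Complex.arg (q / p) * Complex.I := by
    rw [deriv_shortestArc, mul_div_cancel_left₀]
    exact mul_ne_zero hp (Complex.exp_ne_zero _)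
  simp only [hconst, intervalIntegral.integral_const, sub_zero, one_smul]

theorem openCurveIndex_eq {p q : ℂ} (h : NonAntipodal p q) {T : ℝ} {z : ℝ → ℂ}
    (hz : JoinsInside p q T z) {v : ℝ → ℂ}
    (hv : ∀ s ∈ Icc 0 T, HasDerivWithinAt z (v s) (Icc 0 T) s) :
    openCurveIndex z 0 T = 1 / (2 * π * Complex.I) * ((∫ s in (0 : ℝ)..T, v s / z s) -
      2 * Complex.arg (frameEnd (offset p q)) * Complex.I) := by
  have hq : q ≠ 0 := norm_ne_zero_iff.mp (by rw [h.2.1]; exact one_ne_zero)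
  have hcongr : ∫ s in (0 : ℝ)..T, derivWithin z (Icc 0 T) s / z s =
      ∫ s in (0 : ℝ)..T, v s / z s := by
    refine intervalIntegral.integral_congr fun s hs => ?_
    rw [uIcc_of_le hz.pos.le] at hs
    simp only [(hv s hs).derivWithin (uniqueDiffOn_Icc hz.pos s hs)]
  rw [openCurveIndex, hcongr, hz.left, hz.right, integral_shortestArc hq, arg_div_eq h]
  push_cast
  ring

/-! ### The orbits solve the problem -/

/-- The time the orbit with end points `axial δ ± δ i` needs between them. -/
noncomputable def duration (a n δ : ℝ) : ℝ := 2 * endMean a (axial δ) / n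

/-- The time derivative of the eccentric anomaly, from Kepler's equation. -/
noncomputable def anomalyRate (a n δ s : ℝ) : ℝ :=
  n / (ecc a (axial δ) * cosh (anomaly a n δ s) - 1)

/-- The velocity on the orbit with mean motion `n`. -/
noncomputable def frameVelocity (a n δ s : ℝ) : ℂ :=
  ((a * (sinh (anomaly a n δ s) * anomalyRate a n δ s) : ℝ) : ℂ) +
    ((semiminor a δ * (cosh (anomaly a n δ s) * anomalyRate a n δ s) : ℝ) : ℂ) * Complex.I

/-- The orbit from `p` to `q` around the far side of the origin. -/
noncomputable def orbit (a n : ℝ) (p q : ℂ) (s : ℝ) : ℂ :=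
  arcMid p q * frameOrbit a n (offset p q) s

section Orbit

variable {a n δ : ℝ} {p q : ℂ}

theorem anomaly_eq_iff (ha : 0 < a) {s u : ℝ} :
    anomaly a n δ s = u ↔ kepler (ecc a (axial δ)) u = n * s - endMean a (axial δ) :=
  keplerInv_eq_iff (one_le_ecc_axial ha δ)

theorem strictMono_anomaly (ha : 0 < a) (hn : 0 < n) (δ : ℝ) : StrictMono (anomaly a n δ) :=
  fun _ _ hst => strictMono_keplerInv (one_le_ecc_axial ha δ)
    (sub_lt_sub_right (mul_lt_mul_of_pos_left hst hn) _)

theorem anomaly_zero (ha : 0 < a) : anomaly a n δ 0 = -endAnomaly a (axial δ) := by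
  rw [anomaly_eq_iff ha, kepler_neg, endMean]
  ring

theorem anomaly_duration (ha : 0 < a) (hn : 0 < n) :
    anomaly a n δ (duration a n δ) = endAnomaly a (axial δ) := by
  rw [anomaly_eq_iff ha, duration, mul_div_cancel₀ _ hn.ne', endMean]
  ring

theorem anomaly_half_duration (ha : 0 < a) (hn : 0 < n) :
    anomaly a n δ (duration a n δ / 2) = 0 := by
  rw [anomaly_eq_iff ha, kepler_zero, duration]
  field_simp
  ring

theorem duration_pos (ha : 0 < a) (hn : 0 < n) (δ : ℝ) : 0 < duration a n δ :=
  div_pos (mul_pos two_pos (endMean_pos ha (neg_one_lt_axial δ) (axial_le_one δ))) hn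

theorem semiminor_mul_endSinh (ha : 0 < a) (δ : ℝ) : semiminor a δ * endSinh a (axial δ) = δ :=
  div_mul_cancel₀ _ (endSinh_pos ha (neg_one_lt_axial δ)).ne'

theorem framePoint_endAnomaly (ha : 0 < a) (δ : ℝ) :
    framePoint a δ (endAnomaly a (axial δ)) = frameEnd δ := by
  rw [framePoint, cosh_endAnomaly ha (neg_one_lt_axial δ), sinh_endAnomaly ha (neg_one_lt_axial δ),
    endCosh_sub_ecc ha, semiminor_mul_endSinh ha, frameEnd]

theorem framePoint_neg_endAnomaly (ha : 0 < a) (δ : ℝ) :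
    framePoint a δ (-endAnomaly a (axial δ)) = frameEnd (-δ) := by
  rw [← conj_frameEnd, ← framePoint_endAnomaly ha, framePoint, framePoint, cosh_neg, sinh_neg,
    map_add, map_mul, Complex.conj_ofReal, Complex.conj_ofReal, Complex.conj_I, mul_neg, mul_neg,
    Complex.ofReal_neg, neg_mul]

theorem frameOrbit_zero (ha : 0 < a) : frameOrbit a n δ 0 = frameEnd (-δ) := by
  rw [frameOrbit, anomaly_zero ha, framePoint_neg_endAnomaly ha]

theorem frameOrbit_duration (ha : 0 < a) (hn : 0 < n) :
    frameOrbit a n δ (duration a n δ) = frameEnd δ := by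
  rw [frameOrbit, anomaly_duration ha hn, framePoint_endAnomaly ha]

theorem norm_frameOrbit_lt_one (ha : 0 < a) (hn : 0 < n) (hδ : δ ^ 2 < 1) {s : ℝ}
    (hs : s ∈ Ioo 0 (duration a n δ)) : ‖frameOrbit a n δ s‖ < 1 := by
  have hleft := strictMono_anomaly ha hn δ hs.1
  have hright := strictMono_anomaly ha hn δ hs.2
  rw [anomaly_zero ha] at hleft
  rw [anomaly_duration ha hn] at hright
  have hcosh : cosh (anomaly a n δ s) < endCosh a (axial δ) := by
    rw [← cosh_endAnomaly ha (neg_one_lt_axial δ), cosh_lt_cosh]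
    exact (abs_lt.mpr ⟨hleft, hright⟩).trans_le (le_abs_self _)
  have hmul : a * (ecc a (axial δ) * cosh (anomaly a n δ s)) <
      a * (ecc a (axial δ) * endCosh a (axial δ)) := by
    have := ecc_pos ha (axial δ)
    gcongr
  rw [frameOrbit, norm_framePoint ha hδ]
  linarith [ecc_mul_endCosh ha (axial δ)]

theorem joinsInside_orbit (ha : 0 < a) (hn : 0 < n) (h : NonAntipodal p q) :
    JoinsInside p q (duration a n (offset p q)) (orbit a n p q) where
  pos := duration_pos ha hn _
  left := by rw [orbit, frameOrbit_zero ha, arcMid_mul_frameEnd_neg h]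
  right := by rw [orbit, frameOrbit_duration ha hn, arcMid_mul_frameEnd h]
  inside s hs := by
    rw [orbit, norm_mul, norm_arcMid h, one_mul]
    exact norm_frameOrbit_lt_one ha hn (offset_sq_lt_one h) hs

theorem continuous_frameOrbit (ha : 0 < a) : Continuous (frameOrbit a n δ) := by
  have hanomaly : Continuous (anomaly a n δ) :=
    (continuous_keplerInv (one_le_ecc_axial ha δ)).comp (by fun_prop)
  unfold frameOrbit framePoint
  fun_prop

theorem hasDerivAt_anomaly (ha : 0 < a) (hδ : δ ^ 2 < 1) {s : ℝ} (h : frameOrbit a n δ s ≠ 0) :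
    HasDerivAt (anomaly a n δ) (anomalyRate a n δ s) s := by
  have hmean : HasDerivAt (fun s => n * s - endMean a (axial δ)) n s := by
    simpa using ((hasDerivAt_id s).const_mul n).sub_const (endMean a (axial δ))
  have hinv := hasDerivAt_keplerInv (one_le_ecc_axial ha δ) ((framePoint_ne_zero_iff ha hδ _).mp h)
  refine (hinv.comp s hmean).congr_deriv ?_
  rw [mul_comm, ← div_eq_mul_inv, anomalyRate, anomaly]

theorem hasDerivAt_frameOrbit (ha : 0 < a) (hδ : δ ^ 2 < 1) {s : ℝ} (h : frameOrbit a n δ s ≠ 0) :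
    HasDerivAt (frameOrbit a n δ) (frameVelocity a n δ s) s := by
  have hu := hasDerivAt_anomaly ha hδ h
  exact ((hu.cosh.sub_const (ecc a (axial δ))).const_mul a).ofReal_comp.add
    ((hu.sinh.const_mul (semiminor a δ)).ofReal_comp.mul_const Complex.I)

theorem hasDerivAt_anomalyRate (ha : 0 < a) (hδ : δ ^ 2 < 1) {s : ℝ}
    (h : frameOrbit a n δ s ≠ 0) :
    HasDerivAt (anomalyRate a n δ) (-(n ^ 2 * ecc a (axial δ) * sinh (anomaly a n δ s)) /
      (ecc a (axial δ) * cosh (anomaly a n δ s) - 1) ^ 3) s := by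
  have hden := (framePoint_ne_zero_iff ha hδ _).mp h
  have hcosh := (hasDerivAt_anomaly ha hδ h).cosh.const_mul (ecc a (axial δ)) |>.sub_const 1
  refine ((hasDerivAt_const s n).fun_div hcosh hden).congr_deriv ?_
  rw [anomalyRate]
  field_simp
  ring

theorem hasDerivAt_frameVelocity (ha : 0 < a) (hδ : δ ^ 2 < 1) {s : ℝ}
    (h : frameOrbit a n δ s ≠ 0) : HasDerivAt (frameVelocity a n δ)
      (-((n ^ 2 * a ^ 3 / ‖frameOrbit a n δ s‖ ^ 3 : ℝ) : ℂ) * frameOrbit a n δ s) s := by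
  have hu := hasDerivAt_anomaly ha hδ h
  have hrate := hasDerivAt_anomalyRate ha hδ h
  have hden := (framePoint_ne_zero_iff ha hδ _).mp h
  refine (((hu.sinh.mul hrate).const_mul a).ofReal_comp.add
    (((hu.cosh.mul hrate).const_mul (semiminor a δ)).ofReal_comp.mul_const Complex.I)).congr_deriv
    ?_
  rw [anomalyRate, frameOrbit, norm_framePoint ha hδ, framePoint, mul_add (_ : ℂ),
    ← Complex.ofReal_neg, ← Complex.ofReal_mul, ← mul_assoc (_ : ℂ), ← Complex.ofReal_mul]
  set u := anomaly a n δ s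
  set ε := ecc a (axial δ)
  congr 2
  · field_simp
    linear_combination (-ε * n ^ 2 / (ε * cosh u - 1) ^ 3) * sinh_sq u
  · congr 1
    field_simp
    ring

theorem norm_frameVelocity_sq (ha : 0 < a) (hδ : δ ^ 2 < 1) {s : ℝ} (h : frameOrbit a n δ s ≠ 0) :
    ‖frameVelocity a n δ s‖ ^ 2 = n ^ 2 * a ^ 2 + 2 * (n ^ 2 * a ^ 3) / ‖frameOrbit a n δ s‖ := by
  have hden := (framePoint_ne_zero_iff ha hδ _).mp h
  rw [frameOrbit, norm_framePoint ha hδ, frameVelocity, anomalyRate, Complex.norm_add_mul_I,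
    sq_sqrt (by positivity), mul_pow (semiminor a δ), semiminor_sq ha hδ]
  field_simp
  linear_combination n ^ 2 * sinh_sq (anomaly a n δ s)

/-- On the set `S` of times, `z` avoids the origin, moves with velocity `v` and acceleration
`-μ z / |z|³`, and has the energy `e`, that is, `|v|² / 2 = e + μ / |z|`. Derivatives are taken
within `S`, so that one-sided derivatives occur at end times. -/
structure IsKeplerMotion (e μ : ℝ) (z v : ℝ → ℂ) (S : Set ℝ) : Prop where
  ne_zero : ∀ s ∈ S, z s ≠ 0
  hasDerivWithinAt : ∀ s ∈ S, HasDerivWithinAt z (v s) S s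
  hasDerivWithinAt_velocity : ∀ s ∈ S, HasDerivWithinAt v (-(μ / ‖z s‖ ^ 3) • z s) S s
  energy : ∀ s ∈ S, ‖v s‖ ^ 2 = 2 * e + 2 * μ / ‖z s‖

theorem solvesInner_iff_exists_isKeplerMotion {E h μ : ℝ} {z : ℝ → ℂ} {S : Set ℝ} :
    SolvesInner E h μ z S ↔ ∃ v, IsKeplerMotion (E + h) μ z v S := by
  have henergy (x r : ℝ) : 1 / 2 * x - (E + h + μ / r) = 0 ↔ x = 2 * (E + h) + 2 * μ / r :=
    ⟨fun hx => by linear_combination 2 * hx, fun hx => by linear_combination hx / 2⟩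
  constructor
  · rintro ⟨v, hv⟩
    refine ⟨v, fun s hs => (hv s hs).1, fun s hs => (hv s hs).2.1, fun s hs => ?_,
      fun s hs => (henergy _ _).mp (hv s hs).2.2.2⟩
    rw [← (hasGradientAt_innerPotential E h μ (hv s hs).1).gradient]
    exact (hv s hs).2.2.1
  · rintro ⟨v, hne, hz, hv, hnorm⟩
    refine ⟨v, fun s hs => ⟨hne s hs, hz s hs, ?_, (henergy _ _).mpr (hnorm s hs)⟩⟩
    rw [(hasGradientAt_innerPotential E h μ (hne s hs)).gradient]
    exact hv s hs

theorem isKeplerMotion_orbit {S : Set ℝ} (ha : 0 < a) (hpq : NonAntipodal p q)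
    (hS : ∀ s ∈ S, frameOrbit a n (offset p q) s ≠ 0) :
    IsKeplerMotion (n ^ 2 * a ^ 2 / 2) (n ^ 2 * a ^ 3) (orbit a n p q)
      (fun s => arcMid p q * frameVelocity a n (offset p q) s) S := by
  have hδ := offset_sq_lt_one hpq
  have hnorm (s : ℝ) : ‖orbit a n p q s‖ = ‖frameOrbit a n (offset p q) s‖ := by
    rw [orbit, norm_mul, norm_arcMid hpq, one_mul]
  refine ⟨fun s hs => mul_ne_zero (arcMid_ne_zero hpq) (hS s hs),
    fun s hs => ((hasDerivAt_frameOrbit ha hδ (hS s hs)).const_mul _).hasDerivWithinAt,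
    fun s hs => ?_, fun s hs => ?_⟩
  · refine (((hasDerivAt_frameVelocity ha hδ (hS s hs)).const_mul _).congr_deriv
      ?_).hasDerivWithinAt
    rw [hnorm, Complex.real_smul, orbit]
    push_cast
    ring
  · rw [hnorm, norm_mul, norm_arcMid hpq, one_mul, norm_frameVelocity_sq ha hδ (hS s hs)]
    ring

theorem solvesInner_orbit {E h μ : ℝ} {S : Set ℝ} (ha : 0 < a) (hE : E + h = n ^ 2 * a ^ 2 / 2)
    (hμ : μ = n ^ 2 * a ^ 3) (hpq : NonAntipodal p q)
    (hS : ∀ s ∈ S, frameOrbit a n (offset p q) s ≠ 0) : SolvesInner E h μ (orbit a n p q) S := by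
  rw [solvesInner_iff_exists_isKeplerMotion, hE, hμ]
  exact ⟨_, isKeplerMotion_orbit ha hpq hS⟩

theorem isClassicalArc_orbit {E h μ : ℝ} (ha : 0 < a) (hn : 0 < n)
    (hE : E + h = n ^ 2 * a ^ 2 / 2) (hμ : μ = n ^ 2 * a ^ 3) (hpq : NonAntipodal p q)
    (hne : p ≠ q) : IsClassicalArc E h μ p q (duration a n (offset p q)) (orbit a n p q) :=
  ⟨joinsInside_orbit ha hn hpq, solvesInner_orbit ha hE hμ hpq fun s _ =>
    frameOrbit_ne_zero ha (offset_sq_lt_one hpq) (offset_ne_zero hpq hne) s⟩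

theorem semiminor_ne_zero (ha : 0 < a) (hδ : δ ≠ 0) : semiminor a δ ≠ 0 :=
  div_ne_zero hδ (endSinh_pos ha (neg_one_lt_axial δ)).ne'

theorem frameOrbit_re (a n δ s : ℝ) :
    (frameOrbit a n δ s).re = a * (cosh (anomaly a n δ s) - ecc a (axial δ)) := by
  simp [frameOrbit, framePoint]

theorem frameOrbit_im (a n δ s : ℝ) :
    (frameOrbit a n δ s).im = semiminor a δ * sinh (anomaly a n δ s) := by
  simp only [frameOrbit, framePoint, Complex.add_im, Complex.ofReal_im, Complex.im_ofReal_mul,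
    Complex.I_im, mul_one, zero_add]

theorem injective_orbit (ha : 0 < a) (hn : 0 < n) (h : NonAntipodal p q) (hne : p ≠ q) :
    Function.Injective (orbit a n p q) := fun s t hst => by
  have him := congrArg Complex.im (mul_left_cancel₀ (arcMid_ne_zero h) hst)
  rw [frameOrbit_im, frameOrbit_im] at him
  have hsinh := mul_left_cancel₀ (semiminor_ne_zero ha (offset_ne_zero h hne)) him
  exact (strictMono_anomaly ha hn _).injective (sinh_injective hsinh)

/-! ### The index of the orbits -/

theorem neg_frameOrbit_mem_slitPlane (ha : 0 < a) (h0 : δ ≠ 0) (s : ℝ) :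
    -frameOrbit a n δ s ∈ Complex.slitPlane := by
  rw [Complex.mem_slitPlane_iff, Complex.neg_re, Complex.neg_im, frameOrbit_re, frameOrbit_im]
  by_cases hu : anomaly a n δ s = 0
  · left
    rw [hu, cosh_zero]
    nlinarith [one_lt_ecc ha (axial_lt_one h0)]
  · right
    exact neg_ne_zero.mpr (mul_ne_zero (semiminor_ne_zero ha h0) (sinh_ne_zero.mpr hu))

theorem log_neg_frameEnd (hδ : δ ^ 2 < 1) :
    Complex.log (-frameEnd δ) = Complex.arg (-frameEnd δ) * Complex.I := by
  apply Complex.ext <;> simp [Complex.log_re, Complex.log_im, norm_frameEnd hδ]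

theorem arg_frameEnd_neg (hδ : δ ^ 2 < 1) :
    Complex.arg (frameEnd (-δ)) = -Complex.arg (frameEnd δ) := by
  rw [← conj_frameEnd, Complex.arg_conj, if_neg]
  linarith [abs_lt.mp (abs_arg_frameEnd_lt hδ), pi_pos]

theorem log_neg_frameEnd_sub (hδ : δ ^ 2 < 1) (h0 : δ ≠ 0) :
    Complex.log (-frameEnd δ) - Complex.log (-frameEnd (-δ)) =
      2 * Complex.arg (frameEnd δ) * Complex.I - 2 * π * Complex.I ∨
    Complex.log (-frameEnd δ) - Complex.log (-frameEnd (-δ)) =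
      2 * Complex.arg (frameEnd δ) * Complex.I + 2 * π * Complex.I := by
  rw [log_neg_frameEnd hδ, log_neg_frameEnd (by rwa [neg_sq])]
  rcases lt_or_gt_of_ne h0 with hneg | hpos
  · right
    rw [Complex.arg_neg_eq_arg_add_pi_of_im_neg (by rwa [frameEnd_im]),
      Complex.arg_neg_eq_arg_sub_pi_of_im_pos (by rw [frameEnd_im]; linarith),
      arg_frameEnd_neg hδ]
    push_cast
    ring
  · left
    rw [Complex.arg_neg_eq_arg_sub_pi_of_im_pos (by rwa [frameEnd_im]),
      Complex.arg_neg_eq_arg_add_pi_of_im_neg (by rw [frameEnd_im]; linarith),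
      arg_frameEnd_neg hδ]
    push_cast
    ring

-- The orbit avoids the half-axis beyond the origin, so `log (-z)` is a primitive of `z' / z`.
theorem integral_frameVelocity_div_frameOrbit (ha : 0 < a) (hn : 0 < n) (hδ : δ ^ 2 < 1)
    (h0 : δ ≠ 0) :
    ∫ s in (0 : ℝ)..duration a n δ, frameVelocity a n δ s / frameOrbit a n δ s =
      Complex.log (-frameEnd δ) - Complex.log (-frameEnd (-δ)) := by
  have hne := frameOrbit_ne_zero (n := n) ha hδ h0
  have hlog (s : ℝ) : HasDerivAt (fun s => Complex.log (-frameOrbit a n δ s))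
      (frameVelocity a n δ s / frameOrbit a n δ s) s := by
    simpa only [neg_div_neg_eq] using (hasDerivAt_frameOrbit ha hδ (hne s)).fun_neg.clog_real
      (neg_frameOrbit_mem_slitPlane ha h0 s)
  have hvelocity : Continuous (frameVelocity a n δ) := continuous_iff_continuousAt.mpr fun s =>
    (hasDerivAt_frameVelocity ha hδ (hne s)).continuousAt
  rw [intervalIntegral.integral_eq_sub_of_hasDerivAt (fun s _ => hlog s)
    (hvelocity.div (continuous_frameOrbit ha) hne).continuousOn.intervalIntegrable,
    frameOrbit_zero ha, frameOrbit_duration ha hn]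

theorem openCurveIndex_orbit (ha : 0 < a) (hn : 0 < n) (h : NonAntipodal p q) (hne : p ≠ q) :
    openCurveIndex (orbit a n p q) 0 (duration a n (offset p q)) = 1 ∨
      openCurveIndex (orbit a n p q) 0 (duration a n (offset p q)) = -1 := by
  have hδ := offset_sq_lt_one h
  have h0 := offset_ne_zero h hne
  have hpi : (π : ℂ) ≠ 0 := Complex.ofReal_ne_zero.mpr pi_ne_zero
  rw [openCurveIndex_eq h (joinsInside_orbit ha hn h)
    (v := fun s => arcMid p q * frameVelocity a n (offset p q) s) fun s _ =>
      ((hasDerivAt_frameOrbit ha hδ (frameOrbit_ne_zero ha hδ h0 s)).const_mul _).hasDerivWithinAt]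
  simp only [orbit, mul_div_mul_left _ _ (arcMid_ne_zero h)]
  rw [integral_frameVelocity_div_frameOrbit ha hn hδ h0]
  rcases log_neg_frameEnd_sub hδ h0 with hlog | hlog <;> rw [hlog]
  · right
    field_simp
    ring
  · left
    field_simp
    ring

/-! ### Coinciding end points -/

theorem frameOrbit_zero_offset (ha : 0 < a) (n s : ℝ) :
    frameOrbit a n 0 s = ((a * (cosh (anomaly a n 0 s) - 1) : ℝ) : ℂ) := by
  simp [frameOrbit, framePoint, semiminor_zero, axial_zero, ecc_one ha]

theorem frameOrbit_zero_offset_pos (ha : 0 < a) (hn : 0 < n) {s : ℝ}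
    (hs : s ≠ duration a n 0 / 2) : 0 < a * (cosh (anomaly a n 0 s) - 1) := by
  have hanomaly : anomaly a n 0 s ≠ 0 := fun h0 =>
    hs ((strictMono_anomaly ha hn 0).injective (h0.trans (anomaly_half_duration ha hn).symm))
  exact mul_pos ha (sub_pos.mpr (one_lt_cosh.mpr hanomaly))

theorem isEjectionCollisionArc_orbit {E h μ : ℝ} (ha : 0 < a) (hn : 0 < n)
    (hE : E + h = n ^ 2 * a ^ 2 / 2) (hμ : μ = n ^ 2 * a ^ 3) (hp : ‖p‖ = 1) :
    IsEjectionCollisionArc E h μ p p (duration a n (offset p p)) (orbit a n p p) := by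
  have hpp := nonAntipodal_self hp
  have hcont : Continuous (orbit a n p p) := (continuous_frameOrbit ha).const_mul _
  have hT := duration_pos ha hn 0
  have hradial (s : ℝ) : orbit a n p p s = p * ((a * (cosh (anomaly a n 0 s) - 1) : ℝ) : ℂ) := by
    rw [orbit, arcMid_self hp, offset_self, frameOrbit_zero_offset ha]
  refine ⟨joinsInside_orbit ha hn hpp, hcont.continuousOn, ?_⟩
  rw [offset_self]
  refine ⟨duration a n 0 / 2, ⟨by linarith, by linarith⟩, ?_, ?_, p, ?_⟩
  · simp [hradial, anomaly_half_duration ha hn]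
  · refine solvesInner_orbit ha hE hμ hpp fun s hs => ?_
    rw [offset_self, frameOrbit_zero_offset ha]
    exact Complex.ofReal_ne_zero.mpr (frameOrbit_zero_offset_pos ha hn hs.2).ne'
  · refine tendsto_const_nhds.congr' ?_
    filter_upwards [self_mem_nhdsWithin] with s hs
    have hpos := frameOrbit_zero_offset_pos ha hn hs
    rw [hradial, norm_mul, hp, one_mul, Complex.norm_real, norm_of_nonneg hpos.le,
      mul_div_cancel_right₀ _ (Complex.ofReal_ne_zero.mpr hpos.ne')]

/-! ### Transversality -/

theorem inner_mul_mul_of_norm_eq_one {m : ℂ} (hm : ‖m‖ = 1) (x y : ℂ) :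
    inner ℝ (m * x) (m * y) = inner ℝ x y := by
  have hunit : (starRingEnd ℂ) m * m = 1 := by simp [Complex.conj_mul', hm]
  rw [Complex.inner, Complex.inner, map_mul]
  congr 1
  linear_combination ((starRingEnd ℂ) x * y) * hunit

theorem inner_add_mul_I (x y b c : ℝ) :
    inner ℝ ((x : ℂ) + (y : ℂ) * Complex.I) ((b : ℂ) + (c : ℂ) * Complex.I) = x * b + y * c := by
  simp only [Complex.inner, map_add, map_mul, Complex.conj_ofReal, Complex.conj_I, Complex.add_re,
    Complex.mul_re, Complex.add_im, Complex.mul_im, Complex.neg_re, Complex.neg_im,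
    Complex.ofReal_re, Complex.ofReal_im, Complex.I_re, Complex.I_im]
  ring

theorem anomalyRate_of_cosh_eq (ha : 0 < a) {s : ℝ}
    (h : cosh (anomaly a n δ s) = endCosh a (axial δ)) : anomalyRate a n δ s = n * a := by
  have hend : a * (ecc a (axial δ) * endCosh a (axial δ) - 1) = 1 := by
    linarith [ecc_mul_endCosh ha (axial δ)]
  rw [anomalyRate, h, div_eq_iff (right_ne_zero_of_mul_eq_one hend)]
  linear_combination (-n) * hend

theorem axial_mul_add_mul_semiminor (ha : 0 < a) (hδ : δ ^ 2 < 1) :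
    axial δ * (a * endSinh a (axial δ)) + δ * (semiminor a δ * endCosh a (axial δ)) =
      a * (ecc a (axial δ) * endSinh a (axial δ)) := by
  have hcross := ecc_mul_endCosh ha (axial δ)
  have hdiff := endCosh_sub_ecc ha (axial δ)
  have hminor := semiminor_mul_endSinh ha δ
  have hsq := semiminor_sq ha hδ
  generalize ecc a (axial δ) = ε at *
  generalize endCosh a (axial δ) = x at *
  generalize endSinh a (axial δ) = y at *
  linear_combination (-(a * y)) * hdiff - semiminor a δ * x * hminor + x * y * hsq +
    a * ε * y * hcross

theorem inner_frameEnd_frameVelocity_duration (ha : 0 < a) (hn : 0 < n) (hδ : δ ^ 2 < 1) :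
    inner ℝ (frameEnd δ) (frameVelocity a n δ (duration a n δ)) =
      n * a * (a * (ecc a (axial δ) * endSinh a (axial δ))) := by
  have hcosh := cosh_endAnomaly ha (neg_one_lt_axial δ)
  rw [frameVelocity, anomalyRate_of_cosh_eq ha (by rw [anomaly_duration ha hn, hcosh]),
    anomaly_duration ha hn, hcosh, sinh_endAnomaly ha (neg_one_lt_axial δ), frameEnd,
    inner_add_mul_I, ← axial_mul_add_mul_semiminor ha hδ]
  ring

theorem inner_frameEnd_neg_frameVelocity_zero (ha : 0 < a) (hδ : δ ^ 2 < 1) :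
    -inner ℝ (frameEnd (-δ)) (frameVelocity a n δ 0) =
      n * a * (a * (ecc a (axial δ) * endSinh a (axial δ))) := by
  have hcosh : cosh (-endAnomaly a (axial δ)) = endCosh a (axial δ) := by
    rw [cosh_neg, cosh_endAnomaly ha (neg_one_lt_axial δ)]
  rw [frameVelocity, anomalyRate_of_cosh_eq ha (by rw [anomaly_zero ha, hcosh]), anomaly_zero ha,
    hcosh, sinh_neg, sinh_endAnomaly ha (neg_one_lt_axial δ), frameEnd, inner_add_mul_I, axial,
    neg_sq, ← axial, ← axial_mul_add_mul_semiminor ha hδ]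
  ring

theorem norm_frameVelocity_of_norm_eq_one (ha : 0 < a) (hn : 0 < n) (hδ : δ ^ 2 < 1) {s : ℝ}
    (h : ‖frameOrbit a n δ s‖ = 1) : ‖frameVelocity a n δ s‖ = n * a * √(1 + 2 * a) := by
  have hne : frameOrbit a n δ s ≠ 0 := norm_ne_zero_iff.mp (by rw [h]; exact one_ne_zero)
  rw [← sqrt_sq (norm_nonneg _), norm_frameVelocity_sq ha hδ hne, h,
    ← sqrt_sq (mul_pos hn ha).le, ← sqrt_mul (by positivity)]
  congr 1
  ring

/-- The squared cosine of the angle between the velocity and the normal to the circle at the end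
points of the orbit whose end points have component `c` along its axis. -/
noncomputable def sqCosEnd (a c : ℝ) : ℝ := 1 - a ^ 2 * (ecc a c ^ 2 - 1) / (1 + 2 * a)

theorem div_sqrt_eq_sqrt_sqCosEnd {c : ℝ} (ha : 0 < a) (hc : -1 < c) :
    a * (ecc a c * endSinh a c) / √(1 + 2 * a) = √(sqCosEnd a c) := by
  have hnonneg : 0 ≤ a * (ecc a c * endSinh a c) :=
    mul_nonneg ha.le (mul_nonneg (ecc_pos ha c).le (endSinh_pos ha hc).le)
  rw [← sqrt_sq hnonneg, ← sqrt_div (sq_nonneg _), mul_pow, mul_pow, endSinh_sq ha hc, sqCosEnd]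
  congr 1
  field_simp
  linear_combination (a * (ecc a c * endCosh a c) + a + 1) * ecc_mul_endCosh ha c

theorem inner_div_norm_frameVelocity_duration (ha : 0 < a) (hn : 0 < n) (hδ : δ ^ 2 < 1) :
    inner ℝ (frameEnd δ) (frameVelocity a n δ (duration a n δ)) /
      ‖frameVelocity a n δ (duration a n δ)‖ = √(sqCosEnd a (axial δ)) := by
  rw [inner_frameEnd_frameVelocity_duration ha hn hδ, norm_frameVelocity_of_norm_eq_one ha hn hδ
    (by rw [frameOrbit_duration ha hn, norm_frameEnd hδ]),
    mul_div_mul_left _ _ (mul_pos hn ha).ne', div_sqrt_eq_sqrt_sqCosEnd ha (neg_one_lt_axial δ)]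

theorem inner_div_norm_frameVelocity_zero (ha : 0 < a) (hn : 0 < n) (hδ : δ ^ 2 < 1) :
    -inner ℝ (frameEnd (-δ)) (frameVelocity a n δ 0) / ‖frameVelocity a n δ 0‖ =
      √(sqCosEnd a (axial δ)) := by
  rw [inner_frameEnd_neg_frameVelocity_zero ha hδ, norm_frameVelocity_of_norm_eq_one ha hn hδ
    (by rw [frameOrbit_zero ha, norm_frameEnd (by rwa [neg_sq])]),
    mul_div_mul_left _ _ (mul_pos hn ha).ne', div_sqrt_eq_sqrt_sqCosEnd ha (neg_one_lt_axial δ)]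

theorem derivWithin_orbit (ha : 0 < a) (hn : 0 < n) (h : NonAntipodal p q) {s : ℝ}
    (hs : s ∈ Icc 0 (duration a n (offset p q))) (hs0 : frameOrbit a n (offset p q) s ≠ 0) :
    derivWithin (orbit a n p q) (Icc 0 (duration a n (offset p q))) s =
      arcMid p q * frameVelocity a n (offset p q) s :=
  ((hasDerivAt_frameOrbit ha (offset_sq_lt_one h) hs0).const_mul _).hasDerivWithinAt.derivWithin
    (uniqueDiffOn_Icc (duration_pos ha hn _) s hs)

theorem inner_div_norm_derivWithin_orbit_zero (ha : 0 < a) (hn : 0 < n) (h : NonAntipodal p q) :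
    -inner ℝ p (derivWithin (orbit a n p q) (Icc 0 (duration a n (offset p q))) 0) /
      ‖derivWithin (orbit a n p q) (Icc 0 (duration a n (offset p q))) 0‖ =
        √(sqCosEnd a (axial (offset p q))) := by
  have hδ := offset_sq_lt_one h
  have hne : frameOrbit a n (offset p q) 0 ≠ 0 := by
    rw [frameOrbit_zero ha]
    exact frameEnd_ne_zero (by rwa [neg_sq])
  have hinner := inner_mul_mul_of_norm_eq_one (norm_arcMid h) (frameEnd (-offset p q))
    (frameVelocity a n (offset p q) 0)
  rw [arcMid_mul_frameEnd_neg h] at hinner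
  rw [derivWithin_orbit ha hn h (left_mem_Icc.mpr (duration_pos ha hn _).le) hne, hinner,
    norm_mul, norm_arcMid h, one_mul, inner_div_norm_frameVelocity_zero ha hn hδ]

theorem inner_div_norm_derivWithin_orbit_duration (ha : 0 < a) (hn : 0 < n)
    (h : NonAntipodal p q) :
    inner ℝ q (derivWithin (orbit a n p q) (Icc 0 (duration a n (offset p q)))
        (duration a n (offset p q))) /
      ‖derivWithin (orbit a n p q) (Icc 0 (duration a n (offset p q)))
        (duration a n (offset p q))‖ = √(sqCosEnd a (axial (offset p q))) := by
  have hδ := offset_sq_lt_one h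
  have hne : frameOrbit a n (offset p q) (duration a n (offset p q)) ≠ 0 := by
    rw [frameOrbit_duration ha hn]
    exact frameEnd_ne_zero hδ
  have hinner := inner_mul_mul_of_norm_eq_one (norm_arcMid h) (frameEnd (offset p q))
    (frameVelocity a n (offset p q) (duration a n (offset p q)))
  rw [arcMid_mul_frameEnd h] at hinner
  rw [derivWithin_orbit ha hn h (right_mem_Icc.mpr (duration_pos ha hn _).le) hne, hinner,
    norm_mul, norm_arcMid h, one_mul, inner_div_norm_frameVelocity_duration ha hn hδ]

end Orbit

/-! ### Levi-Civita regularisation and uniqueness of classical solutions -/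

theorem eq_of_hasDerivWithinAt_zero {F : Type*} [NormedAddCommGroup F] [NormedSpace ℝ F]
    {g : ℝ → F} {S : Set ℝ} (hS : Convex ℝ S) (hg : ∀ s ∈ S, HasDerivWithinAt g 0 S s) {s t : ℝ}
    (hs : s ∈ S) (ht : t ∈ S) : g s = g t := by
  simpa [sub_eq_zero] using
    hS.norm_image_sub_le_of_norm_hasDerivWithin_le hg (fun x _ => norm_zero.le) ht hs

theorem hasDerivWithinAt_integral_Icc {F : Type*} [NormedAddCommGroup F] [NormedSpace ℝ F]
    [CompleteSpace F] {f : ℝ → F} {T s : ℝ} (hf : ContinuousOn f (Icc 0 T)) (hs : s ∈ Icc 0 T) :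
    HasDerivWithinAt (fun s => ∫ t in (0 : ℝ)..s, f t) (f s) (Icc 0 T) s :=
  have : Fact (s ∈ Icc 0 T) := ⟨hs⟩
  intervalIntegral.integral_hasDerivWithinAt_right
    ((hf.mono (Icc_subset_Icc_right hs.2)).intervalIntegrable_of_Icc hs.1)
    (hf.stronglyMeasurableAtFilter_nhdsWithin measurableSet_Icc s) (hf s hs)

theorem exists_sq_eq_of_hasDerivWithinAt {T : ℝ} {z v : ℝ → ℂ} (hT : 0 ≤ T)
    (hz0 : ∀ s ∈ Icc 0 T, z s ≠ 0) (hz : ∀ s ∈ Icc 0 T, HasDerivWithinAt z (v s) (Icc 0 T) s)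
    (hv : ContinuousOn v (Icc 0 T)) :
    ∃ w : ℝ → ℂ, w T = w 0 * Complex.exp ((∫ s in (0 : ℝ)..T, v s / z s) / 2) ∧
      ∀ s ∈ Icc 0 T, z s = w s ^ 2 ∧
        HasDerivWithinAt w (w s * (v s / z s / 2)) (Icc 0 T) s := by
  have h0 : (0 : ℝ) ∈ Icc 0 T := ⟨le_rfl, hT⟩
  have hlog : ContinuousOn (fun s => v s / z s) (Icc 0 T) :=
    hv.div (fun s hs => (hz s hs).continuousWithinAt) hz0
  obtain ⟨w₀, hw₀⟩ := IsAlgClosed.exists_pow_nat_eq (z 0) two_pos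
  let w : ℝ → ℂ := fun s => w₀ * Complex.exp ((∫ t in (0 : ℝ)..s, v t / z t) / 2)
  have hw (s : ℝ) (hs : s ∈ Icc 0 T) :
      HasDerivWithinAt w (w s * (v s / z s / 2)) (Icc 0 T) s :=
    (((hasDerivWithinAt_integral_Icc hlog hs).div_const 2).cexp.const_mul w₀).congr_deriv
      (mul_assoc _ _ _).symm
  have hw0 : w 0 = w₀ := by simp [w]
  refine ⟨w, by rw [hw0], fun s hs => ⟨?_, hw s hs⟩⟩
  have hquot : w s ^ 2 / z s = w 0 ^ 2 / z 0 :=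
    eq_of_hasDerivWithinAt_zero (g := fun s => w s ^ 2 / z s) (convex_Icc 0 T) (fun t ht => by
      refine (((hw t ht).fun_pow 2).fun_div (hz t ht) (hz0 t ht)).congr_deriv ?_
      have := hz0 t ht
      field_simp
      push_cast
      ring) hs h0
  rw [hw0, hw₀, div_self (hz0 0 h0), div_eq_one_iff_eq (hz0 s hs)] at hquot
  exact hquot.symm

theorem exists_hasDerivWithinAt_symm {T : ℝ} {f : ℝ → ℝ} (hT : 0 < T)
    (hf : ContinuousOn f (Icc 0 T)) (hpos : ∀ s ∈ Icc 0 T, 0 < f s) :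
    ∃ (u : ℝ → ℝ) (U : ℝ), 0 < U ∧ u 0 = -U ∧ u T = U ∧
      ∀ s ∈ Icc 0 T, HasDerivWithinAt u (f s) (Icc 0 T) s := by
  have hint : 0 < ∫ t in (0 : ℝ)..T, f t :=
    intervalIntegral.intervalIntegral_pos_of_pos_on (hf.intervalIntegrable_of_Icc hT.le)
      (fun s hs => hpos s (Ioo_subset_Icc_self hs)) hT
  refine ⟨fun s => (∫ t in (0 : ℝ)..s, f t) - (∫ t in (0 : ℝ)..T, f t) / 2,
    (∫ t in (0 : ℝ)..T, f t) / 2, half_pos hint, by simp, by ring,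
    fun s hs => (hasDerivWithinAt_integral_Icc hf hs).sub_const _⟩

theorem hasDerivWithinAt_conj {z : ℝ → ℂ} {z' : ℂ} {S : Set ℝ} {s : ℝ}
    (hz : HasDerivWithinAt z z' S s) :
    HasDerivWithinAt (fun s => (starRingEnd ℂ) (z s)) ((starRingEnd ℂ) z') S s :=
  Complex.conjCLE.hasFDerivAt.comp_hasDerivWithinAt s hz

/-- The curve `w` with `4 w'' = w`, `w(0) = A` and `w'(0) = B / 2`. In Levi-Civita's coordinate
`w = √z` and his fictitious time, Kepler motions of positive energy are of this form. -/
noncomputable def hyperbolicCurve (A B : ℂ) (u : ℝ) : ℂ :=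
  A * (cosh (u / 2) : ℝ) + B * (sinh (u / 2) : ℝ)

/-- If `f` is the speed of the time change `u`, then `dw/du = P / (2 ω)` and `dP/du = ω w / 2`,
a linear system which hyperbolic functions solve. -/
theorem exists_eq_hyperbolicCurve {ω : ℝ} {S : Set ℝ} {w P : ℝ → ℂ} {u f : ℝ → ℝ} (hω : ω ≠ 0)
    (hS : Convex ℝ S) {s₀ : ℝ} (hs₀ : s₀ ∈ S)
    (hw : ∀ s ∈ S, HasDerivWithinAt w (f s * P s) S s)
    (hP : ∀ s ∈ S, HasDerivWithinAt P (f s * (ω ^ 2 * w s)) S s)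
    (hu : ∀ s ∈ S, HasDerivWithinAt u (f s * (2 * ω)) S s) :
    ∃ A B : ℂ, ∀ s ∈ S, w s = hyperbolicCurve A B (u s) ∧ P s = ω * hyperbolicCurve B A (u s) := by
  have hω' : (ω : ℂ) ≠ 0 := Complex.ofReal_ne_zero.mpr hω
  let A : ℝ → ℂ := fun s => w s * (cosh (u s / 2) : ℝ) - P s / ω * (sinh (u s / 2) : ℝ)
  let B : ℝ → ℂ := fun s => P s / ω * (cosh (u s / 2) : ℝ) - w s * (sinh (u s / 2) : ℝ)
  have hcosh (s : ℝ) (hs : s ∈ S) := ((hu s hs).div_const 2).cosh.ofReal_comp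
  have hsinh (s : ℝ) (hs : s ∈ S) := ((hu s hs).div_const 2).sinh.ofReal_comp
  have hA (s : ℝ) (hs : s ∈ S) : A s = A s₀ := eq_of_hasDerivWithinAt_zero hS (fun t ht => by
    refine (((hw t ht).fun_mul (hcosh t ht)).fun_sub
      (((hP t ht).div_const (ω : ℂ)).fun_mul (hsinh t ht))).congr_deriv ?_
    push_cast
    field_simp
    ring) hs hs₀
  have hB (s : ℝ) (hs : s ∈ S) : B s = B s₀ := eq_of_hasDerivWithinAt_zero hS (fun t ht => by
    refine ((((hP t ht).div_const (ω : ℂ)).fun_mul (hcosh t ht)).fun_sub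
      ((hw t ht).fun_mul (hsinh t ht))).congr_deriv ?_
    push_cast
    field_simp
    ring) hs hs₀
  refine ⟨A s₀, B s₀, fun s hs => ?_⟩
  have hsq : ((cosh (u s / 2) : ℝ) : ℂ) ^ 2 - ((sinh (u s / 2) : ℝ) : ℂ) ^ 2 = 1 := by
    exact_mod_cast cosh_sq_sub_sinh_sq (u s / 2)
  rw [← hA s hs, ← hB s hs]
  simp only [hyperbolicCurve, A, B]
  constructor
  · linear_combination (-w s) * hsq
  · field_simp
    linear_combination (-P s) * hsq

theorem norm_hyperbolicCurve_sq_sub (A B : ℂ) (u : ℝ) :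
    ‖hyperbolicCurve B A u‖ ^ 2 - ‖hyperbolicCurve A B u‖ ^ 2 = ‖B‖ ^ 2 - ‖A‖ ^ 2 := by
  simp only [hyperbolicCurve, Complex.sq_norm, Complex.normSq_apply, Complex.add_re,
    Complex.add_im, Complex.re_mul_ofReal, Complex.im_mul_ofReal]
  linear_combination (B.re ^ 2 + B.im ^ 2 - A.re ^ 2 - A.im ^ 2) * cosh_sq_sub_sinh_sq (u / 2)

section LeviCivita

variable {a n : ℝ} {z v w : ℝ → ℂ} {S : Set ℝ} {s : ℝ}

theorem ofReal_norm_eq_mul_conj {x y : ℂ} (h : x = y ^ 2) :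
    ((‖x‖ : ℝ) : ℂ) = y * (starRingEnd ℂ) y := by
  rw [h, norm_pow, Complex.mul_conj, Complex.normSq_eq_norm_sq]

theorem hasDerivWithinAt_sqrt {z' : ℂ} (hne : z s ≠ 0) (hsq : z s = w s ^ 2)
    (hw : HasDerivWithinAt w (w s * (z' / z s / 2)) S s) :
    HasDerivWithinAt w ((‖z s‖⁻¹ : ℝ) * ((starRingEnd ℂ) (w s) * z' / 2)) S s := by
  have hw0 : w s ≠ 0 := fun h0 => hne (by rw [hsq, h0, zero_pow two_ne_zero])
  have hconj : (starRingEnd ℂ) (w s) ≠ 0 := (map_ne_zero _).mpr hw0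
  refine hw.congr_deriv ?_
  rw [Complex.ofReal_inv, ofReal_norm_eq_mul_conj hsq, hsq]
  field_simp

theorem hasDerivWithinAt_conj_sqrt_mul_velocity
    (hz : IsKeplerMotion (n ^ 2 * a ^ 2 / 2) (n ^ 2 * a ^ 3) z v S) (hs : s ∈ S)
    (hsq : z s = w s ^ 2) (hw : HasDerivWithinAt w (w s * (v s / z s / 2)) S s) :
    HasDerivWithinAt (fun s => (starRingEnd ℂ) (w s) * v s / 2)
      ((‖z s‖⁻¹ : ℝ) * (((n * a / 2 : ℝ) : ℂ) ^ 2 * w s)) S s := by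
  have hw0 : w s ≠ 0 := fun h0 => hz.ne_zero s hs (by rw [hsq, h0, zero_pow two_ne_zero])
  have hconj : (starRingEnd ℂ) (w s) ≠ 0 := (map_ne_zero _).mpr hw0
  have henergy : v s * (starRingEnd ℂ) (v s) =
      n ^ 2 * a ^ 2 + 2 * (n ^ 2 * a ^ 3) / ((‖z s‖ : ℝ) : ℂ) := by
    rw [Complex.mul_conj, Complex.normSq_eq_norm_sq, hz.energy s hs]
    push_cast
    ring
  refine (((hasDerivWithinAt_conj hw).fun_mul
    (hz.hasDerivWithinAt_velocity s hs)).div_const 2).congr_deriv ?_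
  rw [Complex.real_smul]
  push_cast
  rw [ofReal_norm_eq_mul_conj hsq] at henergy ⊢
  rw [hsq]
  simp only [map_mul, map_div₀, map_pow, map_ofNat]
  field_simp at henergy ⊢
  linear_combination henergy

/-- On `[0, T]` the curve `z` is the square of a solution of the regularised equation,
reparametrised by the fictitious time `u`, which is normalised to run from `-U` to `U`. -/
structure IsLeviCivitaLift (a n T : ℝ) (z : ℝ → ℂ) (u : ℝ → ℝ) (A B : ℂ) (U : ℝ) : Prop where
  pos : 0 < U
  left : u 0 = -U
  right : u T = U
  norm_sq_sub : ‖B‖ ^ 2 - ‖A‖ ^ 2 = 2 * a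
  eq_sq : ∀ s ∈ Icc 0 T, z s = hyperbolicCurve A B (u s) ^ 2
  hasDerivWithinAt : ∀ s ∈ Icc 0 T, HasDerivWithinAt u (n * a / ‖z s‖) (Icc 0 T) s

theorem exists_isLeviCivitaLift {T : ℝ} (ha : 0 < a) (hn : 0 < n) (hT : 0 < T)
    (hz : IsKeplerMotion (n ^ 2 * a ^ 2 / 2) (n ^ 2 * a ^ 3) z v (Icc 0 T)) :
    ∃ (u : ℝ → ℝ) (A B : ℂ) (U : ℝ), IsLeviCivitaLift a n T z u A B U ∧
      hyperbolicCurve A B U =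
        hyperbolicCurve A B (-U) * Complex.exp ((∫ s in (0 : ℝ)..T, v s / z s) / 2) := by
  have h0 : (0 : ℝ) ∈ Icc 0 T := ⟨le_rfl, hT.le⟩
  have hT' : T ∈ Icc 0 T := ⟨hT.le, le_rfl⟩
  have hr (s : ℝ) (hs : s ∈ Icc 0 T) : 0 < ‖z s‖ := norm_pos_iff.mpr (hz.ne_zero s hs)
  have hzc : ContinuousOn z (Icc 0 T) := fun s hs => (hz.hasDerivWithinAt s hs).continuousWithinAt
  obtain ⟨w, hwT, hw⟩ := exists_sq_eq_of_hasDerivWithinAt hT.le hz.ne_zero hz.hasDerivWithinAt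
    fun s hs => (hz.hasDerivWithinAt_velocity s hs).continuousWithinAt
  obtain ⟨u, U, hU, hu0, huT, hu⟩ := exists_hasDerivWithinAt_symm (f := fun s => n * a / ‖z s‖) hT
    (continuousOn_const.div hzc.norm fun s hs => (hr s hs).ne')
    fun s hs => div_pos (mul_pos hn ha) (hr s hs)
  obtain ⟨A, B, hAB⟩ := exists_eq_hyperbolicCurve (ω := n * a / 2) (by positivity)
    (convex_Icc 0 T) h0
    (fun s hs => hasDerivWithinAt_sqrt (hz.ne_zero s hs) (hw s hs).1 (hw s hs).2)
    (fun s hs => hasDerivWithinAt_conj_sqrt_mul_velocity hz hs (hw s hs).1 (hw s hs).2)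
    (fun s hs => (hu s hs).congr_deriv (by ring))
  refine ⟨u, A, B, U, ⟨hU, hu0, huT, ?_, fun s hs => ?_, hu⟩, ?_⟩
  · have hvel := congrArg (‖·‖ ^ 2) (hAB 0 h0).2
    have hpos := hr 0 h0
    have hnorm : ‖w 0‖ ^ 2 = ‖z 0‖ := by rw [(hw 0 h0).1, norm_pow]
    simp only [norm_div, norm_mul, RCLike.norm_conj, Complex.norm_ofNat, Complex.norm_real,
      div_pow, mul_pow, hz.energy 0 h0, Real.norm_eq_abs, sq_abs, hnorm] at hvel
    rw [(hAB 0 h0).1] at hnorm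
    rw [← norm_hyperbolicCurve_sq_sub A B (u 0), hnorm]
    field_simp at hvel
    linear_combination -hvel
  · rw [(hw s hs).1, (hAB s hs).1]
  · rw [← huT, ← (hAB T hT').1, hwT, (hAB 0 h0).1, hu0, huT]

end LeviCivita

section BoundaryValues

variable {p q A B : ℂ}

theorem cosh_half_sq (u : ℝ) : cosh (u / 2) ^ 2 = (cosh u + 1) / 2 := by
  have hcosh := cosh_two_mul (u / 2)
  rw [mul_div_cancel₀ u two_ne_zero] at hcosh
  linarith [cosh_sq_sub_sinh_sq (u / 2)]

theorem sinh_half_sq (u : ℝ) : sinh (u / 2) ^ 2 = (cosh u - 1) / 2 := by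
  linarith [cosh_sq_sub_sinh_sq (u / 2), cosh_half_sq u]

theorem hyperbolicCurve_sq (A B : ℂ) (u : ℝ) :
    hyperbolicCurve A B u ^ 2 =
      A ^ 2 * ((cosh u + 1) / 2 : ℝ) + B ^ 2 * ((cosh u - 1) / 2 : ℝ) + A * B * (sinh u : ℝ) := by
  have hsinh : sinh u = 2 * sinh (u / 2) * cosh (u / 2) := by
    rw [← sinh_two_mul, mul_div_cancel₀ u two_ne_zero]
  rw [← cosh_half_sq, ← sinh_half_sq, hsinh, hyperbolicCurve]
  push_cast
  ring

theorem hyperbolicCurve_neg_mul (A B : ℂ) (u : ℝ) :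
    hyperbolicCurve A B (-u) * hyperbolicCurve A B u =
      A ^ 2 * ((cosh u + 1) / 2 : ℝ) - B ^ 2 * ((cosh u - 1) / 2 : ℝ) := by
  rw [← cosh_half_sq, ← sinh_half_sq, hyperbolicCurve, hyperbolicCurve, neg_div, cosh_neg,
    sinh_neg]
  push_cast
  ring

theorem arcMid_mul_axial_sub (h : NonAntipodal p q) :
    arcMid p q * (axial (offset p q) - offset p q * Complex.I) = p := by
  have hp := arcMid_mul_frameEnd_neg h
  rw [← conj_frameEnd, frameEnd] at hp
  simpa [← sub_eq_add_neg] using hp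

theorem arcMid_mul_axial_add (h : NonAntipodal p q) :
    arcMid p q * (axial (offset p q) + offset p q * Complex.I) = q :=
  arcMid_mul_frameEnd h

/-- `hyperbolicCurve A B` runs on `[-U, U]` from a square root of `p` to a square root of `q`. The
product of these roots is `arcMid p q` up to a sign; the sign `-` selects the orbit that passes
on the other side of the origin. -/
structure JoinsSquareRoots (p q A B : ℂ) (U : ℝ) : Prop where
  left : hyperbolicCurve A B (-U) ^ 2 = p
  right : hyperbolicCurve A B U ^ 2 = q
  mul : hyperbolicCurve A B (-U) * hyperbolicCurve A B U = -arcMid p q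

namespace JoinsSquareRoots

variable {U : ℝ}

theorem sq_mul_add_sq_mul (h : JoinsSquareRoots p q A B U) (hpq : NonAntipodal p q) :
    A ^ 2 * ((cosh U + 1 : ℝ) : ℂ) + B ^ 2 * ((cosh U - 1 : ℝ) : ℂ) =
      2 * axial (offset p q) * arcMid p q := by
  have hp := h.left.trans (arcMid_mul_axial_sub hpq).symm
  have hq := h.right.trans (arcMid_mul_axial_add hpq).symm
  rw [hyperbolicCurve_sq] at hp hq
  rw [cosh_neg, sinh_neg] at hp
  push_cast at hp hq ⊢
  linear_combination hp + hq

theorem sq_mul_sub_sq_mul (h : JoinsSquareRoots p q A B U) :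
    A ^ 2 * ((cosh U + 1 : ℝ) : ℂ) - B ^ 2 * ((cosh U - 1 : ℝ) : ℂ) = -2 * arcMid p q := by
  have hmul := h.mul
  rw [hyperbolicCurve_neg_mul] at hmul
  push_cast at hmul ⊢
  linear_combination 2 * hmul

theorem left_coeff_sq (h : JoinsSquareRoots p q A B U) (hpq : NonAntipodal p q) :
    A ^ 2 * ((cosh U + 1 : ℝ) : ℂ) = ((axial (offset p q) - 1 : ℝ) : ℂ) * arcMid p q := by
  rw [Complex.ofReal_sub, Complex.ofReal_one]
  linear_combination (h.sq_mul_add_sq_mul hpq + h.sq_mul_sub_sq_mul) / 2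

theorem right_coeff_sq (h : JoinsSquareRoots p q A B U) (hpq : NonAntipodal p q) :
    B ^ 2 * ((cosh U - 1 : ℝ) : ℂ) = ((axial (offset p q) + 1 : ℝ) : ℂ) * arcMid p q := by
  rw [Complex.ofReal_add, Complex.ofReal_one]
  linear_combination (h.sq_mul_add_sq_mul hpq - h.sq_mul_sub_sq_mul) / 2

theorem coeff_mul (h : JoinsSquareRoots p q A B U) (hpq : NonAntipodal p q) :
    A * B * (sinh U : ℝ) = offset p q * Complex.I * arcMid p q := by
  have hp := h.left.trans (arcMid_mul_axial_sub hpq).symm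
  have hq := h.right.trans (arcMid_mul_axial_add hpq).symm
  rw [hyperbolicCurve_sq] at hp hq
  rw [cosh_neg, sinh_neg] at hp
  push_cast at hp hq ⊢
  linear_combination (hq - hp) / 2

theorem cosh_eq_endCosh {a : ℝ} (h : JoinsSquareRoots p q A B U) (ha : 0 < a)
    (hpq : NonAntipodal p q) (hAB : ‖B‖ ^ 2 - ‖A‖ ^ 2 = 2 * a) :
    cosh U = endCosh a (axial (offset p q)) := by
  have hone := one_le_cosh U
  have hA : ‖A‖ ^ 2 * (cosh U + 1) = 1 - axial (offset p q) := by
    have hnorm := congrArg norm (h.left_coeff_sq hpq)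
    rw [norm_mul, norm_mul, norm_pow, norm_arcMid hpq, Complex.norm_real, Complex.norm_real,
      Real.norm_of_nonneg (by linarith),
      Real.norm_of_nonpos (by linarith [axial_le_one (offset p q)])] at hnorm
    linarith
  have hB : ‖B‖ ^ 2 * (cosh U - 1) = 1 + axial (offset p q) := by
    have hnorm := congrArg norm (h.right_coeff_sq hpq)
    rw [norm_mul, norm_mul, norm_pow, norm_arcMid hpq, Complex.norm_real, Complex.norm_real,
      Real.norm_of_nonneg (by linarith),
      Real.norm_of_nonneg (by linarith [axial_nonneg (offset p q)])] at hnorm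
    linarith
  refine eq_endCosh ha (by linarith) ?_
  linear_combination (cosh U + 1) / 2 * hB - (cosh U - 1) / 2 * hA - (cosh U ^ 2 - 1) / 2 * hAB

theorem eq_endAnomaly {a : ℝ} (h : JoinsSquareRoots p q A B U) (ha : 0 < a)
    (hpq : NonAntipodal p q) (hAB : ‖B‖ ^ 2 - ‖A‖ ^ 2 = 2 * a) (hU : 0 ≤ U) :
    U = endAnomaly a (axial (offset p q)) := by
  rw [endAnomaly, ← h.cosh_eq_endCosh ha hpq hAB, arcosh_cosh hU]

theorem sq_eq_framePoint {a : ℝ} (h : JoinsSquareRoots p q A B U) (ha : 0 < a)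
    (hpq : NonAntipodal p q) (hAB : ‖B‖ ^ 2 - ‖A‖ ^ 2 = 2 * a) (hU : 0 < U) (u : ℝ) :
    hyperbolicCurve A B u ^ 2 = arcMid p q * framePoint a (offset p q) u := by
  set c := axial (offset p q) with hc
  have hX : 1 < cosh U := one_lt_cosh.mpr hU.ne'
  have hXe := h.cosh_eq_endCosh ha hpq hAB
  have hsinh : endSinh a c = sinh U := by
    rw [h.eq_endAnomaly ha hpq hAB hU.le, sinh_endAnomaly ha (neg_one_lt_axial _)]
  have hquad : a * cosh U ^ 2 - c * cosh U = a + 1 := hXe ▸ endCosh_quadratic ha c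
  have hecc : a * ecc a c = a * cosh U - c := by
    rw [hXe]
    linear_combination -endCosh_sub_ecc ha c
  have hadd : cosh U + 1 ≠ 0 := by linarith
  have hsub : cosh U - 1 ≠ 0 := by linarith
  have hre : (c - 1) / (cosh U + 1) * ((cosh u + 1) / 2) +
      (c + 1) / (cosh U - 1) * ((cosh u - 1) / 2) = a * (cosh u - ecc a c) := by
    rw [mul_sub, hecc]
    field_simp
    linear_combination (-2 * cosh u + 2 * cosh U) * hquad
  rw [hyperbolicCurve_sq, framePoint, semiminor, ← hc, hsinh, ← hre,
    eq_div_of_mul_eq (Complex.ofReal_ne_zero.mpr hadd) (h.left_coeff_sq hpq),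
    eq_div_of_mul_eq (Complex.ofReal_ne_zero.mpr hsub) (h.right_coeff_sq hpq),
    eq_div_of_mul_eq (Complex.ofReal_ne_zero.mpr (sinh_pos_iff.mpr hU).ne') (h.coeff_mul hpq)]
  push_cast
  ring

end JoinsSquareRoots

end BoundaryValues

section Uniqueness

variable {E h μ a n T : ℝ} {p q : ℂ} {z v : ℝ → ℂ}

theorem exp_half_integral_of_openCurveIndex (hpq : NonAntipodal p q) (hj : JoinsInside p q T z)
    (hv : ∀ s ∈ Icc 0 T, HasDerivWithinAt z (v s) (Icc 0 T) s)
    (hi : openCurveIndex z 0 T = 1 ∨ openCurveIndex z 0 T = -1) :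
    Complex.exp ((∫ s in (0 : ℝ)..T, v s / z s) / 2) = -frameEnd (offset p q) := by
  rw [openCurveIndex_eq hpq hj hv] at hi
  simp only [one_div, inv_mul_eq_iff_eq_mul₀ Complex.two_pi_I_ne_zero] at hi
  rw [← exp_arg_frameEnd (offset_sq_lt_one hpq)]
  rcases hi with hi | hi
  · rw [show (∫ s in (0 : ℝ)..T, v s / z s) / 2 =
      Complex.arg (frameEnd (offset p q)) * Complex.I + π * Complex.I by
        linear_combination hi / 2, Complex.exp_add, Complex.exp_pi_mul_I, mul_neg_one]
  · rw [show (∫ s in (0 : ℝ)..T, v s / z s) / 2 =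
      Complex.arg (frameEnd (offset p q)) * Complex.I - π * Complex.I by
        linear_combination hi / 2, Complex.exp_sub, Complex.exp_pi_mul_I, div_neg, div_one]

theorem eq_anomaly_of_hasDerivWithinAt {δ : ℝ} {u : ℝ → ℝ} (ha : 0 < a) (hδ : δ ^ 2 < 1)
    (hu0 : u 0 = -endAnomaly a (axial δ)) (hne : ∀ s ∈ Icc 0 T, framePoint a δ (u s) ≠ 0)
    (hu : ∀ s ∈ Icc 0 T, HasDerivWithinAt u (n * a / ‖framePoint a δ (u s)‖) (Icc 0 T) s) {s : ℝ}
    (hs : s ∈ Icc 0 T) : u s = anomaly a n δ s := by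
  have hconst : kepler (ecc a (axial δ)) (u s) - n * s = kepler (ecc a (axial δ)) (u 0) - n * 0 :=
    eq_of_hasDerivWithinAt_zero (g := fun s => kepler (ecc a (axial δ)) (u s) - n * s)
      (convex_Icc 0 T) (fun t ht => by
        refine (((hasDerivAt_kepler (ecc a (axial δ)) (u t)).comp_hasDerivWithinAt t
          (hu t ht)).sub ((hasDerivAt_id t).const_mul n).hasDerivWithinAt).congr_deriv ?_
        have hden := (framePoint_ne_zero_iff ha hδ _).mp (hne t ht)
        rw [norm_framePoint ha hδ]
        field_simp
        ring) hs ⟨le_rfl, hs.1.trans hs.2⟩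
  rw [hu0, kepler_neg, ← endMean, mul_zero, sub_zero] at hconst
  exact ((anomaly_eq_iff ha).mpr (by linarith)).symm

theorem IsLeviCivitaLift.joinsSquareRoots {u : ℝ → ℝ} {A B : ℂ} {U : ℝ}
    (hl : IsLeviCivitaLift a n T z u A B U) (hpq : NonAntipodal p q) (hj : JoinsInside p q T z)
    (hU : hyperbolicCurve A B U = hyperbolicCurve A B (-U) * -frameEnd (offset p q)) :
    JoinsSquareRoots p q A B U := by
  have hp : hyperbolicCurve A B (-U) ^ 2 = p := by
    rw [← hl.left, ← hl.eq_sq 0 ⟨le_rfl, hj.pos.le⟩, hj.left]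
  have hq : hyperbolicCurve A B U ^ 2 = q := by
    rw [← hl.right, ← hl.eq_sq T ⟨hj.pos.le, le_rfl⟩, hj.right]
  refine ⟨hp, hq, ?_⟩
  have hend := frameEnd_mul_frameEnd_neg (offset_sq_lt_one hpq)
  rw [hU, ← mul_assoc, ← pow_two, hp]
  linear_combination frameEnd (offset p q) * arcMid_mul_frameEnd_neg hpq - arcMid p q * hend

theorem eq_orbit_of_isClassicalArc (ha : 0 < a) (hn : 0 < n) (hE : E + h = n ^ 2 * a ^ 2 / 2)
    (hμ : μ = n ^ 2 * a ^ 3) (hpq : NonAntipodal p q) (hz : IsClassicalArc E h μ p q T z)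
    (hi : openCurveIndex z 0 T = 1 ∨ openCurveIndex z 0 T = -1) :
    T = duration a n (offset p q) ∧ EqOn z (orbit a n p q) (Icc 0 T) := by
  obtain ⟨hj, hsol⟩ := hz
  obtain ⟨v, hv⟩ := solvesInner_iff_exists_isKeplerMotion.mp hsol
  rw [hE, hμ] at hv
  have hδ := offset_sq_lt_one hpq
  have hT : T ∈ Icc 0 T := ⟨hj.pos.le, le_rfl⟩
  obtain ⟨u, A, B, U, hl, hU⟩ := exists_isLeviCivitaLift ha hn hj.pos hv
  rw [exp_half_integral_of_openCurveIndex hpq hj hv.hasDerivWithinAt hi] at hU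
  have hroots := hl.joinsSquareRoots hpq hj hU
  have hUe := hroots.eq_endAnomaly ha hpq hl.norm_sq_sub hl.pos.le
  have hzu (s : ℝ) (hs : s ∈ Icc 0 T) : z s = arcMid p q * framePoint a (offset p q) (u s) := by
    rw [hl.eq_sq s hs, hroots.sq_eq_framePoint ha hpq hl.norm_sq_sub hl.pos]
  have hnorm (s : ℝ) (hs : s ∈ Icc 0 T) : ‖z s‖ = ‖framePoint a (offset p q) (u s)‖ := by
    rw [hzu s hs, norm_mul, norm_arcMid hpq, one_mul]
  have hu (s : ℝ) (hs : s ∈ Icc 0 T) : u s = anomaly a n (offset p q) s :=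
    eq_anomaly_of_hasDerivWithinAt ha hδ (by rw [hl.left, hUe])
      (fun t ht h0 => hv.ne_zero t ht (by rw [hzu t ht, h0, mul_zero]))
      (fun t ht => hnorm t ht ▸ hl.hasDerivWithinAt t ht) hs
  refine ⟨(strictMono_anomaly ha hn (offset p q)).injective ?_, fun s hs => ?_⟩
  · rw [← hu T hT, hl.right, hUe, anomaly_duration ha hn]
  · rw [hzu s hs, hu s hs, orbit, frameOrbit]

/-- The two square roots of `p` at the ends of a lift are equal or opposite. If they are equal,
then `B = 0`, against the sign of the energy; if they are opposite, then `A = 0` and the curve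
passes through the origin at the fictitious time `0`. -/
theorem not_isClassicalArc_self (ha : 0 < a) (hn : 0 < n) (hE : E + h = n ^ 2 * a ^ 2 / 2)
    (hμ : μ = n ^ 2 * a ^ 3) : ¬ IsClassicalArc E h μ p p T z := by
  rintro ⟨hj, hsol⟩
  obtain ⟨v, hv⟩ := solvesInner_iff_exists_isKeplerMotion.mp hsol
  rw [hE, hμ] at hv
  have hT := hj.pos
  obtain ⟨u, A, B, U, hl, -⟩ := exists_isLeviCivitaLift ha hn hT hv
  have hends : hyperbolicCurve A B U ^ 2 = hyperbolicCurve A B (-U) ^ 2 := by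
    rw [← hl.left, ← hl.right, ← hl.eq_sq 0 ⟨le_rfl, hT.le⟩, ← hl.eq_sq T ⟨hT.le, le_rfl⟩, hj.left,
      hj.right]
  have hprod : A * B * (sinh U : ℝ) = 0 := by
    rw [hyperbolicCurve_sq, hyperbolicCurve_sq, cosh_neg, sinh_neg] at hends
    push_cast at hends ⊢
    linear_combination hends / 2
  have hsinh : ((sinh U : ℝ) : ℂ) ≠ 0 :=
    Complex.ofReal_ne_zero.mpr (sinh_pos_iff.mpr hl.pos).ne'
  rcases mul_eq_zero.mp ((mul_eq_zero.mp hprod).resolve_right hsinh) with hA | hB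
  · obtain ⟨s, hs, hus⟩ := intermediate_value_Icc hT.le
      (fun t ht => (hl.hasDerivWithinAt t ht).continuousWithinAt)
      (show (0 : ℝ) ∈ Icc (u 0) (u T) by
        rw [hl.left, hl.right]
        constructor <;> linarith [hl.pos])
    exact hv.ne_zero s hs (by simp [hl.eq_sq s hs, hus, hA, hyperbolicCurve])
  · have hAB := hl.norm_sq_sub
    rw [hB, norm_zero] at hAB
    linarith [sq_nonneg ‖A‖]

end Uniqueness

/-! ### Uniqueness of ejection-collision solutions -/

section FallTime

variable {e μ : ℝ}

/-- The reciprocal of the speed at distance `x ≥ 0` from the centre on a Kepler motion of energy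
`e`. It is extended by `0` to `x < 0`, which makes it continuous on the whole line. -/
noncomputable def slowness (e μ x : ℝ) : ℝ := √(max x 0 / (2 * e * max x 0 + 2 * μ))

/-- The time which a free fall of energy `e` takes from distance `r` to the centre. -/
noncomputable def fallTime (e μ r : ℝ) : ℝ := ∫ x in (0 : ℝ)..r, slowness e μ x

theorem continuous_slowness (he : 0 < e) (hμ : 0 < μ) : Continuous (slowness e μ) := by
  unfold slowness
  refine Continuous.sqrt (Continuous.div (by fun_prop) (by fun_prop) fun x => ?_)
  have := le_max_right x 0
  positivity

theorem slowness_pos (he : 0 < e) (hμ : 0 < μ) {x : ℝ} (hx : 0 < x) : 0 < slowness e μ x := by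
  rw [slowness, max_eq_left hx.le]
  positivity

theorem slowness_sq_mul (he : 0 < e) (hμ : 0 < μ) {x : ℝ} (hx : 0 < x) :
    slowness e μ x ^ 2 * (2 * e + 2 * μ / x) = 1 := by
  rw [slowness, max_eq_left hx.le, sq_sqrt (by positivity)]
  field_simp

theorem hasDerivAt_fallTime (he : 0 < e) (hμ : 0 < μ) (r : ℝ) :
    HasDerivAt (fallTime e μ) (slowness e μ r) r :=
  ((continuous_slowness he hμ).integral_hasStrictDerivAt 0 r).hasDerivAt

theorem fallTime_zero (e μ : ℝ) : fallTime e μ 0 = 0 :=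
  intervalIntegral.integral_same

theorem strictMonoOn_fallTime (he : 0 < e) (hμ : 0 < μ) : StrictMonoOn (fallTime e μ) (Ici 0) := by
  refine strictMonoOn_of_deriv_pos (convex_Ici 0)
    (fun r _ => (hasDerivAt_fallTime he hμ r).continuousAt.continuousWithinAt) fun r hr => ?_
  rw [interior_Ici] at hr
  rw [(hasDerivAt_fallTime he hμ r).deriv]
  exact slowness_pos he hμ hr

theorem fallTime_pos (he : 0 < e) (hμ : 0 < μ) {r : ℝ} (hr : 0 < r) : 0 < fallTime e μ r := by
  simpa only [fallTime_zero] using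
    strictMonoOn_fallTime he hμ (mem_Ici.mpr le_rfl) (mem_Ici.mpr hr.le) hr

end FallTime

section RadialMotion

variable {e μ b c s : ℝ} {z v : ℝ → ℂ} {S S' : Set ℝ}

/-- The angular momentum `z ∧ v` of the planar position `z` and the velocity `v`. -/
noncomputable def angularMomentum (z v : ℝ → ℂ) (s : ℝ) : ℝ := ((starRingEnd ℂ) (z s) * v s).im

/-- The radial velocity `⟨z, v⟩ / |z|` of the planar position `z` and the velocity `v`. -/
noncomputable def radialVelocity (z v : ℝ → ℂ) (s : ℝ) : ℝ :=
  ((starRingEnd ℂ) (z s) * v s).re / ‖z s‖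

theorem radialVelocity_sq_add_angularMomentum_sq (hs : z s ≠ 0) :
    ‖z s‖ ^ 2 * radialVelocity z v s ^ 2 + angularMomentum z v s ^ 2 = ‖z s‖ ^ 2 * ‖v s‖ ^ 2 := by
  have hr : ‖z s‖ ≠ 0 := norm_ne_zero_iff.mpr hs
  calc ‖z s‖ ^ 2 * radialVelocity z v s ^ 2 + angularMomentum z v s ^ 2
      = ‖(starRingEnd ℂ) (z s) * v s‖ ^ 2 := by
        rw [radialVelocity, angularMomentum, Complex.sq_norm ((starRingEnd ℂ) (z s) * v s),
          Complex.normSq_apply]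
        field_simp
    _ = ‖z s‖ ^ 2 * ‖v s‖ ^ 2 := by rw [norm_mul, RCLike.norm_conj, mul_pow]

namespace IsKeplerMotion

theorem mono (hz : IsKeplerMotion e μ z v S) (hS : S' ⊆ S) : IsKeplerMotion e μ z v S' where
  ne_zero s hs := hz.ne_zero s (hS hs)
  hasDerivWithinAt s hs := (hz.hasDerivWithinAt s (hS hs)).mono hS
  hasDerivWithinAt_velocity s hs := (hz.hasDerivWithinAt_velocity s (hS hs)).mono hS
  energy s hs := hz.energy s (hS hs)

theorem reverse (hz : IsKeplerMotion e μ z v S) (T : ℝ) :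
    IsKeplerMotion e μ (fun s => z (T - s)) (fun s => -v (T - s)) ((fun s => T - s) ⁻¹' S) := by
  have hsub (s : ℝ) : HasDerivWithinAt (fun s => T - s) (-1) ((fun s => T - s) ⁻¹' S) s :=
    ((hasDerivAt_id s).const_sub T).hasDerivWithinAt
  refine ⟨fun s hs => hz.ne_zero _ hs, fun s hs => ?_, fun s hs => ?_, fun s hs => ?_⟩
  · refine ((hz.hasDerivWithinAt _ hs).scomp s (hsub s) (mapsTo_preimage _ _)).congr_deriv ?_
    rw [neg_one_smul]
  · refine ((hz.hasDerivWithinAt_velocity _ hs).scomp s (hsub s)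
      (mapsTo_preimage _ _)).neg.congr_deriv ?_
    rw [neg_one_smul, neg_neg]
  · rw [norm_neg]
    exact hz.energy _ hs

theorem hasDerivWithinAt_angularMomentum (hz : IsKeplerMotion e μ z v S) (hs : s ∈ S) :
    HasDerivWithinAt (angularMomentum z v) 0 S s := by
  refine (Complex.imCLM.hasFDerivAt.comp_hasDerivWithinAt s
    ((hasDerivWithinAt_conj (hz.hasDerivWithinAt s hs)).fun_mul
      (hz.hasDerivWithinAt_velocity s hs))).congr_deriv ?_
  simp only [Complex.imCLM_apply, Complex.add_im, Complex.mul_im, Complex.conj_re,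
    Complex.conj_im, Complex.smul_re, Complex.smul_im, smul_eq_mul]
  ring

theorem hasDerivWithinAt_norm (hz : IsKeplerMotion e μ z v S) (hs : s ∈ S) :
    HasDerivWithinAt (fun s => ‖z s‖) (radialVelocity z v s) S s := by
  have hr : 0 < ‖z s‖ := norm_pos_iff.mpr (hz.ne_zero s hs)
  have hsqrt := (hz.hasDerivWithinAt s hs).norm_sq.sqrt (pow_pos hr 2).ne'
  simp only [sqrt_sq (norm_nonneg _)] at hsqrt
  refine hsqrt.congr_deriv ?_
  rw [Complex.inner, mul_comm (v s), radialVelocity]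
  field_simp

theorem continuousOn_radialVelocity (hz : IsKeplerMotion e μ z v S) :
    ContinuousOn (radialVelocity z v) S := by
  have hzc : ContinuousOn z S := fun s hs => (hz.hasDerivWithinAt s hs).continuousWithinAt
  have hvc : ContinuousOn v S := fun s hs =>
    (hz.hasDerivWithinAt_velocity s hs).continuousWithinAt
  exact (Complex.continuous_re.comp_continuousOn
    ((Complex.continuous_conj.comp_continuousOn hzc).mul hvc)).div hzc.norm
      fun s hs => norm_ne_zero_iff.mpr (hz.ne_zero s hs)

theorem angularMomentum_sq_le (hz : IsKeplerMotion e μ z v S) (hs : s ∈ S) :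
    angularMomentum z v s ^ 2 ≤ 2 * e * ‖z s‖ ^ 2 + 2 * μ * ‖z s‖ := by
  have hr : ‖z s‖ ≠ 0 := norm_ne_zero_iff.mpr (hz.ne_zero s hs)
  calc angularMomentum z v s ^ 2 ≤ ‖z s‖ ^ 2 * ‖v s‖ ^ 2 := by
        rw [← radialVelocity_sq_add_angularMomentum_sq (hz.ne_zero s hs)]
        exact le_add_of_nonneg_left (by positivity)
    _ = 2 * e * ‖z s‖ ^ 2 + 2 * μ * ‖z s‖ := by
        rw [hz.energy s hs]
        field_simp

theorem angularMomentum_eq_zero_of_tendsto (hz : IsKeplerMotion e μ z v (Ico b c))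
    (hlim : Tendsto z (𝓝[<] c) (𝓝 0)) (hs : s ∈ Ico b c) : angularMomentum z v s = 0 := by
  have hbound : Tendsto (fun t => 2 * e * ‖z t‖ ^ 2 + 2 * μ * ‖z t‖) (𝓝[<] c) (𝓝 0) := by
    simpa using ((hlim.norm.pow 2).const_mul (2 * e)).add (hlim.norm.const_mul (2 * μ))
  have hle : angularMomentum z v s ^ 2 ≤ 0 := by
    refine ge_of_tendsto hbound ?_
    filter_upwards [Ico_mem_nhdsLT (hs.1.trans_lt hs.2)] with t ht
    rw [eq_of_hasDerivWithinAt_zero (convex_Ico b c)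
      (fun _ => hz.hasDerivWithinAt_angularMomentum) hs ht]
    exact hz.angularMomentum_sq_le ht
  exact pow_eq_zero_iff two_ne_zero |>.mp (hle.antisymm (sq_nonneg _))

theorem hasDerivWithinAt_direction (hz : IsKeplerMotion e μ z v S) (hs : s ∈ S)
    (hL : angularMomentum z v s = 0) : HasDerivWithinAt (fun s => z s / (‖z s‖ : ℂ)) 0 S s := by
  have hr : (‖z s‖ : ℂ) ≠ 0 := Complex.ofReal_ne_zero.mpr (norm_ne_zero_iff.mpr (hz.ne_zero s hs))
  refine ((hz.hasDerivWithinAt s hs).fun_div (hz.hasDerivWithinAt_norm hs).ofReal_comp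
    hr).congr_deriv ?_
  have hre : ((((starRingEnd ℂ) (z s) * v s).re : ℝ) : ℂ) = (starRingEnd ℂ) (z s) * v s :=
    Complex.ext (Complex.ofReal_re _) ((Complex.ofReal_im _).trans hL.symm)
  have hnorm : z s * (starRingEnd ℂ) (z s) = (‖z s‖ : ℂ) ^ 2 := Complex.mul_conj' _
  rw [radialVelocity, Complex.ofReal_div, hre, div_eq_zero_iff]
  left
  field_simp
  linear_combination (-v s) * hnorm

theorem radialVelocity_sq (hz : IsKeplerMotion e μ z v S) (hs : s ∈ S)
    (hL : angularMomentum z v s = 0) : radialVelocity z v s ^ 2 = 2 * e + 2 * μ / ‖z s‖ := by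
  have hr : ‖z s‖ ^ 2 ≠ 0 := pow_ne_zero 2 (norm_ne_zero_iff.mpr (hz.ne_zero s hs))
  have hsplit := radialVelocity_sq_add_angularMomentum_sq (v := v) (hz.ne_zero s hs)
  rw [hL, zero_pow two_ne_zero, add_zero] at hsplit
  rw [mul_left_cancel₀ hr hsplit, hz.energy s hs]

theorem slowness_mul_radialVelocity (he : 0 < e) (hμ : 0 < μ) (hz : IsKeplerMotion e μ z v S)
    (hS : IsPreconnected S) (hL : ∀ s ∈ S, angularMomentum z v s = 0) :
    ∃ σ : ℝ, (σ = 1 ∨ σ = -1) ∧ ∀ s ∈ S, slowness e μ ‖z s‖ * radialVelocity z v s = σ := by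
  have hcont : ContinuousOn (fun s => slowness e μ ‖z s‖ * radialVelocity z v s) S :=
    ((continuous_slowness he hμ).comp_continuousOn fun s hs =>
      (hz.hasDerivWithinAt_norm hs).continuousWithinAt).mul hz.continuousOn_radialVelocity
  have hsq : EqOn ((fun s => slowness e μ ‖z s‖ * radialVelocity z v s) ^ 2) (1 ^ 2) S :=
    fun s hs => by
      simp only [Pi.pow_apply, Pi.one_apply, one_pow]
      rw [mul_pow, hz.radialVelocity_sq hs (hL s hs),
        slowness_sq_mul he hμ (norm_pos_iff.mpr (hz.ne_zero s hs))]
  rcases hS.eq_or_eq_neg_of_sq_eq hcont continuousOn_const hsq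
    (fun _ => one_ne_zero) with hσ | hσ
  exacts [⟨1, Or.inl rfl, hσ⟩, ⟨-1, Or.inr rfl, hσ⟩]

theorem fallTime_norm_of_tendsto (he : 0 < e) (hμ : 0 < μ)
    (hz : IsKeplerMotion e μ z v (Ico b c)) (hlim : Tendsto z (𝓝[<] c) (𝓝 0))
    (hs : s ∈ Ico b c) : fallTime e μ ‖z s‖ = c - s := by
  obtain ⟨σ, hσ, hspeed⟩ := hz.slowness_mul_radialVelocity he hμ isPreconnected_Ico
    fun _ => hz.angularMomentum_eq_zero_of_tendsto hlim
  have hderiv : ∀ t ∈ Ico b c,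
      HasDerivWithinAt (fun t => fallTime e μ ‖z t‖ - σ * t) 0 (Ico b c) t := fun t ht => by
    refine (((hasDerivAt_fallTime he hμ ‖z t‖).comp_hasDerivWithinAt t
      (hz.hasDerivWithinAt_norm ht)).sub
        ((hasDerivAt_id t).const_mul σ).hasDerivWithinAt).congr_deriv ?_
    rw [hspeed t ht, mul_one, sub_self]
  have hlim_fallTime : Tendsto (fun t => fallTime e μ ‖z t‖ - σ * t) (𝓝[<] c) (𝓝 (-(σ * c))) := by
    have hfall := (hasDerivAt_fallTime he hμ ‖(0 : ℂ)‖).continuousAt.tendsto.comp hlim.norm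
    rw [norm_zero, fallTime_zero] at hfall
    simpa only [zero_sub, Function.comp_def] using
      hfall.sub (((continuous_const_mul σ).tendsto c).mono_left nhdsWithin_le_nhds)
  have hconst : fallTime e μ ‖z s‖ - σ * s = -(σ * c) := by
    refine tendsto_nhds_unique (tendsto_const_nhds.congr' ?_) hlim_fallTime
    filter_upwards [Ico_mem_nhdsLT (hs.1.trans_lt hs.2)] with t ht
    exact eq_of_hasDerivWithinAt_zero (convex_Ico b c) hderiv hs ht
  rcases hσ with rfl | rfl
  · linarith [fallTime_pos he hμ (norm_pos_iff.mpr (hz.ne_zero s hs)), hs.2]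
  · linarith

theorem direction_eq_of_tendsto (hz : IsKeplerMotion e μ z v (Ico b c))
    (hlim : Tendsto z (𝓝[<] c) (𝓝 0)) (hs : s ∈ Ico b c) :
    z s / (‖z s‖ : ℂ) = z b / (‖z b‖ : ℂ) :=
  eq_of_hasDerivWithinAt_zero (convex_Ico b c)
    (fun _ ht => hz.hasDerivWithinAt_direction ht (hz.angularMomentum_eq_zero_of_tendsto hlim ht))
    hs ⟨le_rfl, hs.1.trans_lt hs.2⟩

theorem fall_along_ray {p : ℂ} (he : 0 < e) (hμ : 0 < μ) (hc : 0 < c) (hp : ‖p‖ = 1)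
    (hz : IsKeplerMotion e μ z v (Ico 0 c)) (hcont : ContinuousOn z (Icc 0 c)) (hz0 : z 0 = p)
    (hzc : z c = 0) :
    c = fallTime e μ 1 ∧ ∀ s ∈ Icc 0 c, z s = ‖z s‖ * p ∧ fallTime e μ ‖z s‖ = c - s := by
  have hlim : Tendsto z (𝓝[<] c) (𝓝 0) := by
    rw [← nhdsWithin_Ico_eq_nhdsLT hc, ← hzc]
    exact (hcont c ⟨hc.le, le_rfl⟩).mono Ico_subset_Icc_self
  refine ⟨?_, fun s hs => ?_⟩
  · simpa [hz0, hp] using (hz.fallTime_norm_of_tendsto he hμ hlim ⟨le_rfl, hc⟩).symm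
  rcases hs.2.eq_or_lt with rfl | hlt
  · simp [hzc, fallTime_zero]
  · refine ⟨?_, hz.fallTime_norm_of_tendsto he hμ hlim ⟨hs.1, hlt⟩⟩
    have hr : (‖z s‖ : ℂ) ≠ 0 :=
      Complex.ofReal_ne_zero.mpr (norm_ne_zero_iff.mpr (hz.ne_zero s ⟨hs.1, hlt⟩))
    have hdir := hz.direction_eq_of_tendsto hlim ⟨hs.1, hlt⟩
    rwa [hz0, hp, Complex.ofReal_one, div_one, div_eq_iff hr, mul_comm] at hdir

end IsKeplerMotion

theorem ejectionCollisionArc_radial {E h μ T : ℝ} {p : ℂ} {z : ℝ → ℂ} (he : 0 < E + h)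
    (hμ : 0 < μ) (hp : ‖p‖ = 1) (hz : IsEjectionCollisionArc E h μ p p T z) :
    T = 2 * fallTime (E + h) μ 1 ∧ ∀ s ∈ Icc 0 T,
      z s = ‖z s‖ * p ∧ fallTime (E + h) μ ‖z s‖ = |s - fallTime (E + h) μ 1| := by
  obtain ⟨hj, hcont, c, hc, hzc, hsolves, -⟩ := hz
  obtain ⟨v, hv⟩ := solvesInner_iff_exists_isKeplerMotion.mp hsolves
  have hfall : IsKeplerMotion (E + h) μ z v (Ico 0 c) :=
    hv.mono fun s hs => ⟨⟨hs.1, (hs.2.trans hc.2).le⟩, hs.2.ne⟩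
  have hreverse : IsKeplerMotion (E + h) μ (fun s => z (T - s)) (fun s => -v (T - s))
      (Ico 0 (T - c)) :=
    (hv.reverse T).mono fun s hs => ⟨⟨by linarith [hs.2, hc.1], by linarith [hs.1]⟩,
      fun hsc => by linarith [hs.2, (show T - s = c from hsc)]⟩
  obtain ⟨hc_eq, hbefore⟩ := hfall.fall_along_ray he hμ hc.1 hp
    (hcont.mono (Icc_subset_Icc_right hc.2.le)) hj.left hzc
  obtain ⟨hTc_eq, hafter⟩ := hreverse.fall_along_ray he hμ (sub_pos.mpr hc.2) hp
    (hcont.comp (by fun_prop) fun s hs => ⟨by linarith [hs.2, hc.1], by linarith [hs.1]⟩)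
    (by rw [sub_zero, hj.right]) (by rw [sub_sub_cancel, hzc])
  refine ⟨by linarith, fun s hs => ?_⟩
  rw [← hc_eq]
  rcases le_total s c with hsc | hsc
  · obtain ⟨hray, htime⟩ := hbefore s ⟨hs.1, hsc⟩
    exact ⟨hray, by rw [htime, abs_of_nonpos (by linarith), neg_sub]⟩
  · obtain ⟨hray, htime⟩ := hafter (T - s) ⟨by linarith [hs.2], by linarith⟩
    simp only [sub_sub_cancel] at hray htime
    exact ⟨hray, by rw [htime, abs_of_nonneg (by linarith)]; ring⟩

theorem ejectionCollisionArc_unique {E h μ T T' : ℝ} {p : ℂ} {z z' : ℝ → ℂ} (he : 0 < E + h)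
    (hμ : 0 < μ) (hp : ‖p‖ = 1) (hz : IsEjectionCollisionArc E h μ p p T z)
    (hz' : IsEjectionCollisionArc E h μ p p T' z') : T' = T ∧ EqOn z' z (Icc 0 T') := by
  obtain ⟨hT, hradial⟩ := ejectionCollisionArc_radial he hμ hp hz
  obtain ⟨hT', hradial'⟩ := ejectionCollisionArc_radial he hμ hp hz'
  have hTT' : T' = T := hT'.trans hT.symm
  refine ⟨hTT', fun s hs => ?_⟩
  obtain ⟨hray, htime⟩ := hradial s (hTT' ▸ hs)
  obtain ⟨hray', htime'⟩ := hradial' s hs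
  have hnorm : ‖z' s‖ = ‖z s‖ := (strictMonoOn_fallTime he hμ).injOn (norm_nonneg _)
    (norm_nonneg _) (htime'.trans htime.symm)
  rw [hray, hray', hnorm]

end RadialMotion

/-! ### Dependence on the end points -/

section EndPoints

variable {a n : ℝ} {p q : ℂ}

theorem contDiff_circlePoint : ContDiff ℝ 1 circlePoint :=
  Complex.contDiff_exp.comp (Complex.ofRealCLM.contDiff.mul contDiff_const)

theorem contDiff_circlePoint_pair :
    ContDiff ℝ 1 (fun ξ : ℝ × ℝ => (circlePoint ξ.1, circlePoint ξ.2)) :=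
  (contDiff_circlePoint.comp contDiff_fst).prodMk (contDiff_circlePoint.comp contDiff_snd)

theorem contDiffAt_norm_add (h : NonAntipodal p q) :
    ContDiffAt ℝ 1 (fun x : ℂ × ℂ => ‖x.1 + x.2‖) (p, q) :=
  (contDiffAt_fst.add contDiffAt_snd).norm ℝ (norm_pos_iff.mp (norm_add_pos h))

theorem contDiffAt_arcMid (h : NonAntipodal p q) :
    ContDiffAt ℝ 1 (fun x : ℂ × ℂ => arcMid x.1 x.2) (p, q) := by
  have hnorm : ContDiffAt ℝ 1 (fun x : ℂ × ℂ => (‖x.1 + x.2‖ : ℂ)) (p, q) :=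
    Complex.ofRealCLM.contDiff.contDiffAt.comp (p, q) (contDiffAt_norm_add h)
  simpa only [arcMid, div_eq_mul_inv, Pi.inv_apply] using
    (contDiffAt_fst.add contDiffAt_snd).mul
      (hnorm.inv (Complex.ofReal_ne_zero.mpr (norm_add_pos h).ne'))

theorem contDiffAt_offset (h : NonAntipodal p q) :
    ContDiffAt ℝ 1 (fun x : ℂ × ℂ => offset x.1 x.2) (p, q) := by
  have him : ContDiff ℝ 1 (fun x : ℂ × ℂ => (x.2 * (starRingEnd ℂ) x.1).im) :=
    Complex.imCLM.contDiff.comp (contDiff_snd.mul (Complex.conjCLE.contDiff.comp contDiff_fst))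
  exact him.contDiffAt.div (contDiffAt_norm_add h) (norm_add_pos h).ne'

theorem contDiffAt_duration (ha : 0 < a) (h : NonAntipodal p q) :
    ContDiffAt ℝ 1 (fun x : ℂ × ℂ => duration a n (offset x.1 x.2)) (p, q) :=
  (contDiffAt_const.mul (ContDiffAt.comp (g := fun δ => endMean a (axial δ)) (p, q)
    (contDiffAt_endMean_axial ha (offset_sq_lt_one h)) (contDiffAt_offset h))).div_const n

theorem contDiffAt_orbit_fixed_time (ha : 0 < a) (h : NonAntipodal p q) (s : ℝ) :
    ContDiffAt ℝ 1 (fun x : ℂ × ℂ => orbit a n x.1 x.2 s) (p, q) :=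
  (contDiffAt_arcMid h).mul (ContDiffAt.comp (g := fun δ => frameOrbit a n δ s) (p, q)
    (contDiffAt_frameOrbit_fixed_time ha (offset_sq_lt_one h) s) (contDiffAt_offset h))

theorem contDiffAt_orbit (ha : 0 < a) (h : NonAntipodal p q) {s : ℝ} (hs : orbit a n p q s ≠ 0) :
    ContDiffAt ℝ 1 (fun x : ℝ × ℂ × ℂ => orbit a n x.2.1 x.2.2 x.1) (s, p, q) := by
  have hoffset : ContDiffAt ℝ 1 (fun x : ℝ × ℂ × ℂ => offset x.2.1 x.2.2) (s, p, q) :=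
    ContDiffAt.comp (g := fun x : ℂ × ℂ => offset x.1 x.2) (s, p, q) (contDiffAt_offset h)
      contDiffAt_snd
  have harcMid : ContDiffAt ℝ 1 (fun x : ℝ × ℂ × ℂ => arcMid x.2.1 x.2.2) (s, p, q) :=
    ContDiffAt.comp (g := fun x : ℂ × ℂ => arcMid x.1 x.2) (s, p, q) (contDiffAt_arcMid h)
      contDiffAt_snd
  exact harcMid.mul (contDiffAt_frameOrbit ha hoffset contDiffAt_fst (offset_sq_lt_one h)
    (right_ne_zero_of_mul hs))

theorem contDiffOn_duration_circlePoint (ha : 0 < a) :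
    ContDiffOn ℝ 1
      (fun ξ : ℝ × ℝ => duration a n (offset (circlePoint ξ.1) (circlePoint ξ.2)))
      {ξ | NonAntipodal (circlePoint ξ.1) (circlePoint ξ.2)} := fun ξ hξ =>
  (ContDiffAt.comp (g := fun x : ℂ × ℂ => duration a n (offset x.1 x.2)) ξ
    (contDiffAt_duration ha hξ) contDiff_circlePoint_pair.contDiffAt).contDiffWithinAt

theorem contDiffOn_orbit_circlePoint_fixed_time (ha : 0 < a) (s : ℝ) :
    ContDiffOn ℝ 1 (fun ξ : ℝ × ℝ => orbit a n (circlePoint ξ.1) (circlePoint ξ.2) s)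
      {ξ | NonAntipodal (circlePoint ξ.1) (circlePoint ξ.2)} := fun ξ hξ =>
  (ContDiffAt.comp (g := fun x : ℂ × ℂ => orbit a n x.1 x.2 s) ξ
    (contDiffAt_orbit_fixed_time ha hξ s) contDiff_circlePoint_pair.contDiffAt).contDiffWithinAt

theorem contDiffOn_orbit_circlePoint (ha : 0 < a) :
    ContDiffOn ℝ 1
      (fun x : ℝ × ℝ × ℝ => orbit a n (circlePoint x.2.1) (circlePoint x.2.2) x.1)
      {x | NonAntipodal (circlePoint x.2.1) (circlePoint x.2.2) ∧
        orbit a n (circlePoint x.2.1) (circlePoint x.2.2) x.1 ≠ 0} := fun x hx =>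
  (ContDiffAt.comp (g := fun x : ℝ × ℂ × ℂ => orbit a n x.2.1 x.2.2 x.1) x
    (contDiffAt_orbit ha hx.1 hx.2)
    (contDiffAt_fst.prodMk
      (contDiff_circlePoint_pair.comp contDiff_snd).contDiffAt)).contDiffWithinAt

theorem continuousAt_orbit (ha : 0 < a) (h : NonAntipodal p q) (s : ℝ) :
    ContinuousAt (fun x : (ℂ × ℂ) × ℝ => orbit a n x.1.1 x.1.2 x.2) ((p, q), s) := by
  have hoffset : ContinuousAt (fun x : (ℂ × ℂ) × ℝ => offset x.1.1 x.1.2) ((p, q), s) :=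
    ContinuousAt.comp (g := fun x : ℂ × ℂ => offset x.1 x.2) (contDiffAt_offset h).continuousAt
      continuousAt_fst
  have harcMid : ContinuousAt (fun x : (ℂ × ℂ) × ℝ => arcMid x.1.1 x.1.2) ((p, q), s) :=
    ContinuousAt.comp (g := fun x : ℂ × ℂ => arcMid x.1 x.2) (contDiffAt_arcMid h).continuousAt
      continuousAt_fst
  exact harcMid.mul (tendsto_frameOrbit ha hoffset continuousAt_snd (offset_sq_lt_one h))

theorem continuousAt_duration_right (ha : 0 < a) (h : NonAntipodal p q) :
    ContinuousAt (fun q => duration a n (offset p q)) q :=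
  ContinuousAt.comp (g := fun x : ℂ × ℂ => duration a n (offset x.1 x.2)) (f := fun q => (p, q))
    (contDiffAt_duration ha h).continuousAt (Continuous.prodMk_right p).continuousAt

theorem continuousOn_orbit_rescaled (ha : 0 < a) (p : ℂ) (S : Set ℝ) :
    ContinuousOn
      (Function.uncurry fun q t => orbit a n p q (t * duration a n (offset p q)))
      ({q | NonAntipodal p q} ×ˢ S) := by
  rintro ⟨q, t⟩ ⟨hq, -⟩
  have hduration : ContinuousAt (fun x : ℂ × ℝ => duration a n (offset p x.1)) (q, t) :=
    ContinuousAt.comp (g := fun q => duration a n (offset p q)) (continuousAt_duration_right ha hq)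
      continuousAt_fst
  exact (ContinuousAt.comp (g := fun x : (ℂ × ℂ) × ℝ => orbit a n x.1.1 x.1.2 x.2)
    (f := fun x : ℂ × ℝ => ((p, x.1), x.2 * duration a n (offset p x.1)))
    (continuousAt_orbit ha hq _) ((continuousAt_const.prodMk continuousAt_fst).prodMk
      (continuousAt_snd.mul hduration))).continuousWithinAt

theorem tendstoUniformlyOn_of_continuousOn_prod {X Y Z : Type*} [TopologicalSpace X]
    [TopologicalSpace Y] [UniformSpace Z] {f : X → Y → Z} {s : Set X} {k : Set Y} {x : X}
    (hk : IsCompact k) (hf : ContinuousOn f.uncurry (s ×ˢ k)) (hx : x ∈ s) :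
    TendstoUniformlyOn f (f x) (𝓝[s] x) k := fun V hV => by
  obtain ⟨W, hW, hfW⟩ := hk.mem_uniformity_of_prod hf hx (symm_le_uniformity hV)
  exact mem_of_superset hW hfW

theorem nhdsWithin_sphere_le_nonAntipodal (hp : ‖p‖ = 1) :
    𝓝[Metric.sphere 0 1] p ≤ 𝓝[{q | NonAntipodal p q}] p := by
  refine nhdsWithin_le_iff.mpr ?_
  filter_upwards [self_mem_nhdsWithin, nhdsWithin_le_nhds (Metric.ball_mem_nhds p two_pos)]
    with q hq hpq
  exact ⟨hp, mem_sphere_zero_iff_norm.mp hq, by rwa [← dist_eq_norm, dist_comm]⟩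

theorem tendsto_duration (ha : 0 < a) (hp : ‖p‖ = 1) :
    Tendsto (fun q => duration a n (offset p q)) (𝓝 p) (𝓝 (duration a n (offset p p))) :=
  continuousAt_duration_right ha (nonAntipodal_self hp)

theorem tendstoUniformlyOn_orbit_rescaled (ha : 0 < a) (hp : ‖p‖ = 1) :
    TendstoUniformlyOn (fun q t => orbit a n p q (t * duration a n (offset p q)))
      (fun t => orbit a n p p (t * duration a n (offset p p))) (𝓝[Metric.sphere 0 1] p)
      (Icc 0 1) := fun V hV =>
  nhdsWithin_sphere_le_nonAntipodal hp (tendstoUniformlyOn_of_continuousOn_prod isCompact_Icc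
    (continuousOn_orbit_rescaled ha p _) (nonAntipodal_self hp) V hV)

end EndPoints

/-! ### The scale of the orbits and the transversality constants -/

section Constants

variable {e μ d : ℝ}

/-- The semi-major axis of the Kepler hyperbolas of energy `e`. -/
noncomputable def semiAxis (e μ : ℝ) : ℝ := μ / (2 * e)

/-- The mean motion of the Kepler hyperbolas of energy `e`, that is, the rate at which the mean
anomaly grows with time. -/
noncomputable def meanMotion (e μ : ℝ) : ℝ := √(2 * e) / semiAxis e μ

/-- A lower bound, uniform in the end points, for the cosine of the angle at which the orbits
cross the unit circle. -/
noncomputable def minCos (e μ : ℝ) : ℝ := √((1 + semiAxis e μ) / (1 + 2 * semiAxis e μ))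

/-- A lower bound for the cosine of the angle at which the orbits with end points at distance `d`
cross the unit circle. The cosine itself is `√(sqCosEnd a (axial (d / 2)))` with `a` the semi-major
axis; its square lies strictly below it for `d ≠ 0`, but is `1` for `d = 0`. -/
noncomputable def cosBound (e μ d : ℝ) : ℝ :=
  if d = 0 then minCos e μ else max (minCos e μ) (sqCosEnd (semiAxis e μ) (axial (d / 2)))

theorem semiAxis_pos (he : 0 < e) (hμ : 0 < μ) : 0 < semiAxis e μ :=
  div_pos hμ (mul_pos two_pos he)

theorem meanMotion_pos (he : 0 < e) (hμ : 0 < μ) : 0 < meanMotion e μ :=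
  div_pos (sqrt_pos.mpr (mul_pos two_pos he)) (semiAxis_pos he hμ)

theorem eq_meanMotion_sq_mul_semiAxis_sq_div_two (he : 0 < e) (hμ : 0 < μ) :
    e = meanMotion e μ ^ 2 * semiAxis e μ ^ 2 / 2 := by
  rw [← mul_pow, meanMotion, div_mul_cancel₀ _ (semiAxis_pos he hμ).ne', sq_sqrt (by positivity),
    mul_div_cancel_left₀ _ two_ne_zero]

theorem eq_meanMotion_sq_mul_semiAxis_cube (he : 0 < e) (hμ : 0 < μ) :
    μ = meanMotion e μ ^ 2 * semiAxis e μ ^ 3 := by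
  calc μ = 2 * e * semiAxis e μ := by rw [semiAxis, mul_div_cancel₀ _ (by positivity)]
    _ = meanMotion e μ ^ 2 * semiAxis e μ ^ 3 := by
      linear_combination 2 * semiAxis e μ * eq_meanMotion_sq_mul_semiAxis_sq_div_two he hμ

theorem lt_sqCosEnd {a c : ℝ} (ha : 0 < a) (hc : 0 < c) :
    (1 + a) / (1 + 2 * a) < sqCosEnd a c := by
  have hecc : a ^ 2 * (ecc a c ^ 2 - 1) < a :=
    calc a ^ 2 * (ecc a c ^ 2 - 1) < a ^ 2 * (1 / a) := by
          gcongr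
          linarith [ecc_sq_lt ha hc]
      _ = a := by field_simp
  rw [sqCosEnd, lt_sub_iff_add_lt, ← add_div, div_lt_one (by positivity)]
  linarith

theorem sqCosEnd_lt_one {a c : ℝ} (ha : 0 < a) (hc : c < 1) : sqCosEnd a c < 1 := by
  have hecc : 0 < ecc a c ^ 2 - 1 := sub_pos.mpr (one_lt_pow₀ (one_lt_ecc ha hc) two_ne_zero)
  exact sub_lt_self 1 (by positivity)

theorem sqCosEnd_one {a : ℝ} (ha : 0 < a) : sqCosEnd a 1 = 1 := by
  rw [sqCosEnd, ecc_one ha, one_pow, sub_self, mul_zero, zero_div, sub_zero]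

theorem continuous_sqCosEnd {a : ℝ} (ha : 0 < a) : Continuous (sqCosEnd a) := by
  have hecc : Continuous (ecc a) :=
    continuous_iff_continuousAt.mpr fun c => (contDiffAt_ecc ha c).continuousAt
  unfold sqCosEnd
  fun_prop

theorem half_sq_lt_one (h0 : 0 ≤ d) (h2 : d < 2) : (d / 2) ^ 2 < 1 := by
  rw [sq_lt_one_iff₀ (by linarith)]
  linarith

theorem minCos_pos (he : 0 < e) (hμ : 0 < μ) : 0 < minCos e μ := by
  have := semiAxis_pos he hμ
  unfold minCos
  positivity

theorem minCos_lt_one (he : 0 < e) (hμ : 0 < μ) : minCos e μ < 1 := by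
  have := semiAxis_pos he hμ
  rw [minCos, sqrt_lt' one_pos, one_pow, div_lt_one (by positivity)]
  linarith

theorem minCos_le_cosBound (e μ d : ℝ) : minCos e μ ≤ cosBound e μ d := by
  unfold cosBound
  split_ifs
  exacts [le_rfl, le_max_left _ _]

theorem cosBound_lt_one (he : 0 < e) (hμ : 0 < μ) (d : ℝ) : cosBound e μ d < 1 := by
  unfold cosBound
  split_ifs with hd
  exacts [minCos_lt_one he hμ, max_lt (minCos_lt_one he hμ) (sqCosEnd_lt_one (semiAxis_pos he hμ)
    (axial_lt_one (div_ne_zero hd two_ne_zero)))]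

theorem cosBound_lt_sqrt_sqCosEnd (he : 0 < e) (hμ : 0 < μ) (h0 : 0 ≤ d) (h2 : d < 2) :
    cosBound e μ d < √(sqCosEnd (semiAxis e μ) (axial (d / 2))) := by
  have ha := semiAxis_pos he hμ
  have hsq := lt_sqCosEnd ha (axial_pos (half_sq_lt_one h0 h2))
  have hmin : minCos e μ < √(sqCosEnd (semiAxis e μ) (axial (d / 2))) :=
    sqrt_lt_sqrt (by positivity) hsq
  unfold cosBound
  split_ifs with hd
  · exact hmin
  · have hpos : 0 < sqCosEnd (semiAxis e μ) (axial (d / 2)) := lt_trans (by positivity) hsq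
    have hlt := sqCosEnd_lt_one ha (axial_lt_one (div_ne_zero hd two_ne_zero))
    exact max_lt hmin (lt_sqrt_of_sq_lt (pow_lt_self_of_lt_one₀ hpos hlt one_lt_two))

theorem tendsto_cosBound (he : 0 < e) (hμ : 0 < μ) :
    Tendsto (fun d => cosBound e μ d) (𝓝[>] 0) (𝓝 1) := by
  have ha := semiAxis_pos he hμ
  have hcont : Continuous fun d => max (minCos e μ) (sqCosEnd (semiAxis e μ) (axial (d / 2))) := by
    have := continuous_sqCosEnd ha
    unfold axial
    fun_prop
  have hlim : Tendsto (fun d => max (minCos e μ) (sqCosEnd (semiAxis e μ) (axial (d / 2))))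
      (𝓝[>] 0) (𝓝 1) :=
    hcont.tendsto' 0 1 (by simp [axial_zero, sqCosEnd_one ha, (minCos_lt_one he hμ).le])
      |>.mono_left nhdsWithin_le_nhds
  refine hlim.congr' ?_
  filter_upwards [self_mem_nhdsWithin] with d hd
  rw [cosBound, if_neg (ne_of_gt hd)]

theorem tendsto_minCos (μ : ℝ) : Tendsto (fun e => minCos e μ) atTop (𝓝 1) := by
  have haxis : Tendsto (fun e => semiAxis e μ) atTop (𝓝 0) :=
    tendsto_const_nhds.div_atTop (tendsto_id.const_mul_atTop two_pos)
  simpa [minCos] using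
    ((haxis.const_add 1).div ((haxis.const_mul 2).const_add 1) (by norm_num)).sqrt

theorem cosBound_norm_sub_lt {p q : ℂ} (he : 0 < e) (hμ : 0 < μ) (h : NonAntipodal p q) :
    cosBound e μ ‖p - q‖ < √(sqCosEnd (semiAxis e μ) (axial (offset p q))) := by
  rw [axial_offset_eq_axial_half_norm_sub h]
  exact cosBound_lt_sqrt_sqCosEnd he hμ (norm_nonneg _) h.2.2

end Constants

end HyperbolicKepler

open HyperbolicKepler in
theorem mainTheorem9 :
    -- transversality constants depending on `E + h` and `μ`, resp. also on `|p₀ - p₁|`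
    ∃ (C₀ : ℝ → ℝ → ℝ) (C : ℝ → ℝ → ℝ → ℝ),
      (∀ e μ : ℝ, 0 < e → 0 < μ → 0 < C₀ e μ ∧
        (∀ d ∈ Ico (0 : ℝ) 2, C₀ e μ ≤ C e μ d ∧ C e μ d < 1) ∧
        Tendsto (fun d => C e μ d) (𝓝[>] 0) (𝓝 1)) ∧
      (∀ μ : ℝ, 0 < μ → Tendsto (fun e => C₀ e μ) atTop (𝓝 1)) ∧
      ∀ E h μ : ℝ, 0 < E + h → 0 < μ →
        ∃ (T : ℂ → ℂ → ℝ) (z : ℂ → ℂ → ℝ → ℂ),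
          -- coinciding end points: the unique solution is an ejection-collision one
          (∀ p : ℂ, ‖p‖ = 1 →
            IsEjectionCollisionArc E h μ p p (T p p) (z p p) ∧
            ∀ (T' : ℝ) (z' : ℝ → ℂ),
              (IsEjectionCollisionArc E h μ p p T' z' ∨ IsClassicalArc E h μ p p T' z') →
              T' = T p p ∧ EqOn z' (z p p) (Icc 0 T')) ∧
          -- distinct end points: the unique classical solution of index `1` or `-1`
          (∀ p₀ p₁ : ℂ, NonAntipodal p₀ p₁ → p₀ ≠ p₁ →
            IsClassicalArc E h μ p₀ p₁ (T p₀ p₁) (z p₀ p₁) ∧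
            InjOn (z p₀ p₁) (Icc 0 (T p₀ p₁)) ∧
            (openCurveIndex (z p₀ p₁) 0 (T p₀ p₁) = 1 ∨
              openCurveIndex (z p₀ p₁) 0 (T p₀ p₁) = -1) ∧
            ∀ (T' : ℝ) (z' : ℝ → ℂ), IsClassicalArc E h μ p₀ p₁ T' z' →
              (openCurveIndex z' 0 T' = 1 ∨ openCurveIndex z' 0 T' = -1) →
              T' = T p₀ p₁ ∧ EqOn z' (z p₀ p₁) (Icc 0 T')) ∧
          -- `C¹` dependence on the end points: of the duration,
          ContDiffOn ℝ 1 (fun ξ : ℝ × ℝ => T (circlePoint ξ.1) (circlePoint ξ.2))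
            {ξ | NonAntipodal (circlePoint ξ.1) (circlePoint ξ.2)} ∧
          -- of the position at every fixed time (collision included),
          (∀ s : ℝ, ContDiffOn ℝ 1
            (fun ξ : ℝ × ℝ => z (circlePoint ξ.1) (circlePoint ξ.2) s)
            {ξ | NonAntipodal (circlePoint ξ.1) (circlePoint ξ.2) ∧
              s ∈ Icc 0 (T (circlePoint ξ.1) (circlePoint ξ.2))}) ∧
          -- and, away from the collision, jointly with time
          ContDiffOn ℝ 1
            (fun x : ℝ × ℝ × ℝ => z (circlePoint x.2.1) (circlePoint x.2.2) x.1)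
            {x | NonAntipodal (circlePoint x.2.1) (circlePoint x.2.2) ∧
              x.1 ∈ Icc 0 (T (circlePoint x.2.1) (circlePoint x.2.2)) ∧
              z (circlePoint x.2.1) (circlePoint x.2.2) x.1 ≠ 0} ∧
          -- convergence to the ejection-collision solution as `p₁ → p₀`, in durations and
          -- uniformly in the rescaled time
          (∀ p₀ : ℂ, ‖p₀‖ = 1 →
            Tendsto (fun p₁ => T p₀ p₁) (𝓝[Metric.sphere 0 1] p₀) (𝓝 (T p₀ p₀)) ∧
            TendstoUniformlyOn (fun p₁ t => z p₀ p₁ (t * T p₀ p₁))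
              (fun t => z p₀ p₀ (t * T p₀ p₀)) (𝓝[Metric.sphere 0 1] p₀) (Icc 0 1)) ∧
          -- transversality to the circle at both end points
          ∀ p₀ p₁ : ℂ, NonAntipodal p₀ p₁ →
            C (E + h) μ ‖p₀ - p₁‖ <
              -inner ℝ p₀ (derivWithin (z p₀ p₁) (Icc 0 (T p₀ p₁)) 0) /
                ‖derivWithin (z p₀ p₁) (Icc 0 (T p₀ p₁)) 0‖ ∧
            C (E + h) μ ‖p₀ - p₁‖ <
              inner ℝ p₁ (derivWithin (z p₀ p₁) (Icc 0 (T p₀ p₁)) (T p₀ p₁)) /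
                ‖derivWithin (z p₀ p₁) (Icc 0 (T p₀ p₁)) (T p₀ p₁)‖ := by
  refine ⟨minCos, cosBound, fun e μ he hμ => ⟨minCos_pos he hμ, fun d _ =>
    ⟨minCos_le_cosBound e μ d, cosBound_lt_one he hμ d⟩, tendsto_cosBound he hμ⟩,
    fun μ _ => tendsto_minCos μ, fun E h μ he hμ => ?_⟩
  have ha := semiAxis_pos he hμ
  have hn := meanMotion_pos he hμ
  have hE := eq_meanMotion_sq_mul_semiAxis_sq_div_two he hμ
  have hμa := eq_meanMotion_sq_mul_semiAxis_cube he hμ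
  set a := semiAxis (E + h) μ
  set n := meanMotion (E + h) μ
  refine ⟨fun p q => duration a n (offset p q), orbit a n, fun p hp => ?_,
    fun p₀ p₁ hpq hne => ⟨isClassicalArc_orbit ha hn hE hμa hpq hne,
      (injective_orbit ha hn hpq hne).injOn, openCurveIndex_orbit ha hn hpq hne,
      fun T' z' hz' hi => eq_orbit_of_isClassicalArc ha hn hE hμa hpq hz' hi⟩,
    contDiffOn_duration_circlePoint ha,
    fun s => (contDiffOn_orbit_circlePoint_fixed_time ha s).mono fun _ hξ => hξ.1,
    (contDiffOn_orbit_circlePoint ha).mono fun _ hx => ⟨hx.1, hx.2.2⟩,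
    fun p₀ hp => ⟨(tendsto_duration ha hp).mono_left nhdsWithin_le_nhds,
      tendstoUniformlyOn_orbit_rescaled ha hp⟩, fun p₀ p₁ hpq => ?_⟩
  · have hec := isEjectionCollisionArc_orbit ha hn hE hμa hp
    exact ⟨hec, fun T' z' hz' => hz'.elim (ejectionCollisionArc_unique he hμ hp hec)
      fun hcl => absurd hcl (not_isClassicalArc_self ha hn hE hμa)⟩
  · rw [inner_div_norm_derivWithin_orbit_zero ha hn hpq,
      inner_div_norm_derivWithin_orbit_duration ha hn hpq, and_self]
    exact cosBound_norm_sub_lt he hμ hpq
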